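/- Let $\gamma\ge 1$, let $\mathcal B\subset\mathbb C$ be a finite non-empty set with $\Re\beta\ge\gamma$ for all $\beta\in\mathcal B$, let $s>0$, and put $\theta_\beta(z)=1/(z+\beta)$. Let $G_\gamma=\{z\in\mathbb C:|z-\tfrac1{2\gamma}|<\tfrac1{2\gamma}\}$, and let $H\subset\mathbb C=\mathbb R^2$ be a bounded open set with $G_\gamma\subset H$ and $\Re z>0$ for all $z\in H$. Assume that $H$ is mildly regular: there are $\eta>0$ and $M\ge1$ such that any $x,y\in H$ with $|x-y|<\eta$ are joined by a Lipschitz path $\psi:[0,1]\to H$, $\psi(0)=x$, $\psi(1)=y$, with $\int_0^1|\psi'(t)|\,dt\le M|x-y|$. For an integer $m\ge1$ let $C^m(\bar H)$ be the space of real-valued $C^m$ functions $f$ on $H$ all of whose partial derivatives $D^\alpha f$, $|\alpha|\le m$, extend continuously to $\bar H$ (the extensions are denoted by the same symbols), with the norm $\|f\|=\sup\{|D^\alpha f(z)|:z\in H,\ |\alpha|\le m\}$. Then $\theta_\beta(H)\subset G_\gamma$ for all $\beta\in\mathcal B$, and $$(\Lambda_s f)(z)=\sum_{\beta\in\mathcal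 B}\Big|\frac{d\theta_\beta}{dz}(z)\Big|^s f(\theta_\beta(z)),\qquad z\in\bar H,$$ defines a bounded linear operator $\Lambda_s:C^m(\bar H)\to C^m(\bar H)$. It has an eigenvector $v_s\in C^m(\bar H)$ with $v_s(z)>0$ for all $z\in\bar H$; every eigenvector of $\Lambda_s$ in $C^m(\bar H)$ that is strictly positive on $\bar H$ is a positive multiple of $v_s$; and $v_s\in C^k(\bar H)$ for every $k$, that is, $v_s$ is $C^\infty$. Moreover, writing $z=x+iy=(x,y)$, $D_1=\partial/\partial x$ and $D_2=\partial/\partial y$, for all $(x,y)\in\bar H$: $$-\frac{2s}{\gamma}\le\frac{D_1v_s}{v_s}\le0,\qquad -\frac{s}{4\gamma^2(s+1)}\le\frac{D_1^2v_s}{v_s}\le\frac{2s(2s+1)}{\gamma^2},$$ $$-\frac{2s(2s+1)(2s+2)}{\gamma^3}\le\frac{D_1^3v_s}{v_s}\le\frac{2s(2s+2)}{\gamma^3(s+2)^2},$$ $$-\frac{2s(2s+2)(3s+3)}{\gamma^4}\le\frac{D_1^4v_s}{v_s}\le\frac{2s(2s+1)(2s+2)(2s+3)}{\gamma^4},$$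 $$\frac{|D_2v_s|}{v_s}\le\frac s\gamma,\qquad -\frac{2s}{\gamma^2}\le\frac{D_2^2v_s}{v_s}\le\frac{2s(2s+1)}{4\gamma^2},$$ $$\frac{|D_2^3v_s|}{v_s}\le\frac{2s(2s+2)}{\gamma^3}\max\Big\{\frac{25\sqrt5}{72},\frac{2s+1}{8}\Big\},$$ $$-\frac{2s(2s+2)(3s+3)}{\gamma^4}\le\frac{D_2^4v_s}{v_s}\le\frac{2s(2s+1)(2s+2)(2s+3)}{\gamma^4},$$ and, for $k=1,2$ and $1\le j\le4$, $$\frac{|D_k^jv_s|}{v_s}\le\frac{(2s)(2s+1)\cdots(2s+j-1)}{\gamma^j}.$$ -/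

import Mathlib

open TopologicalSpace Set

/-- The Möbius map `θ_β(z) = 1 / (z + β)`. -/
noncomputable def mobiusTheta (β z : ℂ) : ℂ := 1 / (z + β)

/-- The open disc `G_γ = {z : |z - 1/(2γ)| < 1/(2γ)}`. -/
def discG (γ : ℝ) : Set ℂ := {z : ℂ | ‖z - 1 / (2 * (γ : ℂ))‖ < 1 / (2 * γ)}

/-- A set `H` is mildly regular if nearby points `x, y` of `H` can be joined inside `H` by a
Lipschitz path of length at most `M * |x - y|`, with `M` and the threshold `η` uniform in
`x, y`. A Lipschitz path is differentiable almost everywhere, and the integral only involves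
the values of `ψ` on `[0,1]`. -/
def MildlyRegular (H : Set ℂ) : Prop :=
  ∃ η > (0 : ℝ), ∃ M ≥ (1 : ℝ), ∀ x ∈ H, ∀ y ∈ H, ‖x - y‖ < η →
    ∃ ψ : ℝ → ℂ, (∃ K : NNReal, LipschitzOnWith K ψ (Icc 0 1)) ∧ MapsTo ψ (Icc 0 1) H ∧
      ψ 0 = x ∧ ψ 1 = y ∧ ∫ t in (0 : ℝ)..1, ‖deriv ψ t‖ ≤ M * ‖x - y‖

/-- `∂f/∂x` for `f : ℂ → ℝ`, where `z = x + i y`. -/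
noncomputable def partialX (f : ℂ → ℝ) (z : ℂ) : ℝ := fderiv ℝ f z 1

/-- `∂f/∂y` for `f : ℂ → ℝ`, where `z = x + i y`. -/
noncomputable def partialY (f : ℂ → ℝ) (z : ℂ) : ℝ := fderiv ℝ f z Complex.I

/-- `D^α f = (∂/∂x)^a (∂/∂y)^b f` for the multi-index `α = (a, b)`. -/
noncomputable def partialD (a b : ℕ) (f : ℂ → ℝ) : ℂ → ℝ := partialX^[a] (partialY^[b] f)

open Classical in
/-- A function on `closure H`, viewed as a function on `ℂ` by giving it the value `0` outside.
It is used only to evaluate `f` at points of `closure H` and to differentiate `f` at points of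
the open set `H`. -/
noncomputable def zeroExt {H : Opens ℂ} (f : closure (H : Set ℂ) → ℝ) (z : ℂ) : ℝ :=
  if h : z ∈ closure (H : Set ℂ) then f ⟨z, h⟩ else 0

/-- The value at `z` of the continuous extension of `D^(a,b) f` from `H` to `closure H`. -/
noncomputable def partialDBar {H : Opens ℂ} (a b : ℕ) (f : closure (H : Set ℂ) → ℝ)
    (z : closure (H : Set ℂ)) : ℝ :=
  extendFrom (H : Set ℂ) (partialD a b (zeroExt f)) (z : ℂ)

/-- Membership in `C^m` of the closure of `H`: `f` is continuous on `closure H`, is `C^m` in `H`,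
and each partial derivative of order at most `m` extends from `H` to a (bounded) continuous
function on `closure H`. For bounded `H` the boundedness is automatic. -/
def IsCmBar (m : ℕ) (H : Opens ℂ) (f : closure (H : Set ℂ) → ℝ) : Prop :=
  Continuous f ∧ ContDiffOn ℝ m (zeroExt f) H ∧
    ∀ a b : ℕ, a + b ≤ m → ∃ g : BoundedContinuousFunction (closure (H : Set ℂ)) ℝ,
      ∀ z : closure (H : Set ℂ), (z : ℂ) ∈ H → g z = partialD a b (zeroExt f) z

section Helpers

variable {H : Opens ℂ}

theorem zeroExt_add (f g : closure (H : Set ℂ) → ℝ) :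
    zeroExt (f + g) = zeroExt f + zeroExt g := by
  funext z
  by_cases h : z ∈ closure (H : Set ℂ) <;> simp [zeroExt, h]

theorem zeroExt_smul (c : ℝ) (f : closure (H : Set ℂ) → ℝ) :
    zeroExt (c • f) = c • zeroExt f := by
  funext z
  by_cases h : z ∈ closure (H : Set ℂ) <;> simp [zeroExt, h]

theorem zeroExt_zero : zeroExt (0 : closure (H : Set ℂ) → ℝ) = 0 := by
  funext z
  by_cases h : z ∈ closure (H : Set ℂ) <;> simp [zeroExt, h]

/-- Differentiation in a fixed direction lowers the order of smoothness by one. -/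
theorem contDiffOn_dir (e : ℂ) {n : ℕ} {f : ℂ → ℝ} (hf : ContDiffOn ℝ (n + 1 : ℕ) f H) :
    ContDiffOn ℝ n (fun z => fderiv ℝ f z e) H :=
  (hf.fderiv_of_isOpen H.isOpen (m := (n : WithTop ℕ∞)) (by exact_mod_cast le_rfl)).clm_apply
    contDiffOn_const

theorem eqOn_dir (e : ℂ) {f g : ℂ → ℝ} (h : EqOn f g H) :
    EqOn (fun z => fderiv ℝ f z e) (fun z => fderiv ℝ g z e) H := by
  intro z hz
  have : f =ᶠ[nhds z] g := Filter.eventuallyEq_of_mem (H.isOpen.mem_nhds hz) h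
  simp [this.fderiv_eq]

/-- Iterated differentiation in a fixed direction: smoothness and linearity. -/
theorem iterate_dir (e : ℂ) (T : (ℂ → ℝ) → ℂ → ℝ) (hT : ∀ f z, T f z = fderiv ℝ f z e)
    (a n : ℕ) {f g k : ℂ → ℝ} (c d : ℝ) (hf : ContDiffOn ℝ (n + a : ℕ) f H)
    (hg : ContDiffOn ℝ (n + a : ℕ) g H) (hk : EqOn k (c • f + d • g) H) :
    ContDiffOn ℝ n (T^[a] f) H ∧ ContDiffOn ℝ n (T^[a] g) H ∧
      EqOn (T^[a] k) (c • T^[a] f + d • T^[a] g) H := by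
  have hT' : ∀ f, T f = fun z => fderiv ℝ f z e := fun f => funext (hT f)
  induction a generalizing f g k with
  | zero => exact ⟨hf, hg, hk⟩
  | succ a ih =>
    simp only [Function.iterate_succ_apply]
    refine ih (f := T f) (g := T g) (k := T k) ?_ ?_ ?_
    · rw [hT']; exact contDiffOn_dir e hf
    · rw [hT']; exact contDiffOn_dir e hg
    · rw [hT', hT', hT']
      intro z hz
      have h1 := eqOn_dir e hk hz
      have hne : ((n + (a + 1) : ℕ) : WithTop ℕ∞) ≠ 0 := by
        exact_mod_cast Nat.succ_ne_zero (n + a)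
      have hfd : DifferentiableAt ℝ f z :=
        (hf.differentiableOn hne).differentiableAt (H.isOpen.mem_nhds hz)
      have hgd : DifferentiableAt ℝ g z :=
        (hg.differentiableOn hne).differentiableAt (H.isOpen.mem_nhds hz)
      change fderiv ℝ k z e = c * fderiv ℝ f z e + d * fderiv ℝ g z e
      change fderiv ℝ k z e = fderiv ℝ (c • f + d • g) z e at h1
      rw [h1, fderiv_add (hfd.const_smul c) (hgd.const_smul d), fderiv_const_smul hfd,
        fderiv_const_smul hgd]
      simp

theorem partialD_lin {m : ℕ} {f g : ℂ → ℝ} (c d : ℝ) (hf : ContDiffOn ℝ m f H)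
    (hg : ContDiffOn ℝ m g H) {a b : ℕ} (hab : a + b ≤ m) {z : ℂ} (hz : z ∈ H) :
    partialD a b (c • f + d • g) z = c * partialD a b f z + d * partialD a b g z := by
  have h1 : ((a + b : ℕ) : WithTop ℕ∞) ≤ m := by exact_mod_cast hab
  obtain ⟨p, q, r⟩ := iterate_dir (H := H) Complex.I partialY (fun _ _ => rfl) b a c d
    (hf.of_le h1) (hg.of_le h1) (fun _ _ => rfl)
  obtain ⟨-, -, t⟩ := iterate_dir (H := H) 1 partialX (fun _ _ => rfl) a 0 c d
    (by simpa using p) (by simpa using q) r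
  simpa [partialD] using t hz

theorem IsCmBar.lin {m : ℕ} {f g : closure (H : Set ℂ) → ℝ} (c d : ℝ) (hf : IsCmBar m H f)
    (hg : IsCmBar m H g) : IsCmBar m H (c • f + d • g) := by
  have e : zeroExt (c • f + d • g) = c • zeroExt f + d • zeroExt g := by
    rw [zeroExt_add, zeroExt_smul, zeroExt_smul]
  refine ⟨(hf.1.const_smul c).add (hg.1.const_smul d), ?_, fun a b hab => ?_⟩
  · rw [e]; exact (hf.2.1.const_smul c).add (hg.2.1.const_smul d)
  · obtain ⟨p, hp⟩ := hf.2.2 a b hab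
    obtain ⟨q, hq⟩ := hg.2.2 a b hab
    refine ⟨c • p + d • q, fun z hz => ?_⟩
    rw [e, partialD_lin c d hf.2.1 hg.2.1 hab hz, ← hp z hz, ← hq z hz]
    simp

theorem partialD_zero_fun (a b : ℕ) : partialD a b (0 : ℂ → ℝ) = 0 := by
  have hx : partialX (0 : ℂ → ℝ) = 0 := by funext z; simp [partialX]
  have hy : partialY (0 : ℂ → ℝ) = 0 := by funext z; simp [partialY]
  rw [partialD, Function.iterate_fixed hy, Function.iterate_fixed hx]

theorem isCmBar_zero (m : ℕ) : IsCmBar m H 0 := by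
  refine ⟨continuous_zero, ?_, fun a b _ => ⟨0, fun z _ => ?_⟩⟩
  · rw [zeroExt_zero]; exact contDiffOn_const
  · rw [zeroExt_zero, partialD_zero_fun]; rfl

end Helpers

/-- `C^m` functions on the closure of `H`, as a space of real functions on `closure H`. -/
def cmBarSubmodule (m : ℕ) (H : Opens ℂ) : Submodule ℝ (closure (H : Set ℂ) → ℝ) where
  carrier := {f | IsCmBar m H f}
  add_mem' {f g} hf hg := by simpa using IsCmBar.lin 1 1 hf hg
  zero_mem' := isCmBar_zero m
  smul_mem' c f hf := by simpa using IsCmBar.lin c 0 hf (isCmBar_zero m)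

/-- The real vector space `C^m` of the closure of `H`; its norm is given below. -/
def CmBar (m : ℕ) (H : Opens ℂ) : Type := cmBarSubmodule m H

namespace CmBar

variable {m : ℕ} {H : Opens ℂ}

noncomputable instance instAddCommGroup : AddCommGroup (CmBar m H) :=
  inferInstanceAs (AddCommGroup (cmBarSubmodule m H))

noncomputable instance instModule : Module ℝ (CmBar m H) :=
  inferInstanceAs (Module ℝ (cmBarSubmodule m H))

/-- The underlying function on `closure H`. -/
def toFun (f : CmBar m H) : closure (H : Set ℂ) → ℝ := f.1

instance instCoeFun : CoeFun (CmBar m H) (fun _ => closure (H : Set ℂ) → ℝ) := ⟨toFun⟩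

theorem isCmBar (f : CmBar m H) : IsCmBar m H f := f.2

/-- The numbers `|D^α f(z)|` with `z ∈ H` and `|α| ≤ m`. -/
def derivValues (f : CmBar m H) : Set ℝ :=
  {r | ∃ a b : ℕ, a + b ≤ m ∧ ∃ z ∈ H, r = |partialD a b (zeroExt f) z|}

/-- The norm `‖f‖ = sup {|D^α f(z)| : z ∈ H, |α| ≤ m}`. -/
noncomputable instance instNorm : Norm (CmBar m H) := ⟨fun f => sSup f.derivValues⟩

theorem norm_def (f : CmBar m H) : ‖f‖ = sSup f.derivValues := rfl

theorem bddAbove_derivValues (f : CmBar m H) : BddAbove f.derivValues := by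
  classical
  choose g hg using f.isCmBar.2.2
  refine ⟨∑ a ∈ Finset.range (m + 1), ∑ b ∈ Finset.range (m + 1),
    if h : a + b ≤ m then ‖g a b h‖ else 0, ?_⟩
  rintro r ⟨a, b, hab, z, hz, rfl⟩
  have hnn : ∀ a b, 0 ≤ (if h : a + b ≤ m then ‖g a b h‖ else 0) := by
    intro a b; split_ifs <;> positivity
  have h1 : |partialD a b (zeroExt f) z| ≤ ‖g a b hab‖ := by
    rw [← hg a b hab ⟨z, subset_closure hz⟩ hz]
    exact (g a b hab).norm_coe_le_norm _
  calc _ ≤ (if h : a + b ≤ m then ‖g a b h‖ else 0) := by rw [dif_pos hab]; exact h1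
    _ ≤ ∑ b ∈ Finset.range (m + 1), if h : a + b ≤ m then ‖g a b h‖ else 0 :=
      Finset.single_le_sum (f := fun b => if h : a + b ≤ m then ‖g a b h‖ else 0)
        (fun b _ => hnn a b) (Finset.mem_range.2 (by omega))
    _ ≤ _ := Finset.single_le_sum
        (f := fun a => ∑ b ∈ Finset.range (m + 1), if h : a + b ≤ m then ‖g a b h‖ else 0)
        (fun a _ => Finset.sum_nonneg (fun b _ => hnn a b)) (Finset.mem_range.2 (by omega))

theorem norm_nonneg' (f : CmBar m H) : 0 ≤ ‖f‖ := by
  refine Real.sSup_nonneg ?_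
  rintro r ⟨a, b, -, z, -, rfl⟩
  exact abs_nonneg _

theorem abs_partialD_le_norm (f : CmBar m H) {a b : ℕ} (hab : a + b ≤ m) {z : ℂ} (hz : z ∈ H) :
    |partialD a b (zeroExt f) z| ≤ ‖f‖ :=
  le_csSup f.bddAbove_derivValues ⟨a, b, hab, z, hz, rfl⟩

theorem norm_le_of_forall {f : CmBar m H} {C : ℝ} (hC : 0 ≤ C)
    (h : ∀ a b : ℕ, a + b ≤ m → ∀ z ∈ H, |partialD a b (zeroExt f) z| ≤ C) : ‖f‖ ≤ C := by
  refine Real.sSup_le ?_ hC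
  rintro r ⟨a, b, hab, z, hz, rfl⟩
  exact h a b hab z hz

theorem zeroExt_lin (c d : ℝ) (f g : CmBar m H) :
    zeroExt (c • f + d • g : CmBar m H) = c • zeroExt f + d • zeroExt g := by
  rw [← zeroExt_smul, ← zeroExt_smul, ← zeroExt_add]; rfl

theorem norm_lin_le (c d : ℝ) (f g : CmBar m H) :
    ‖c • f + d • g‖ ≤ |c| * ‖f‖ + |d| * ‖g‖ := by
  have hf := f.norm_nonneg'
  have hg := g.norm_nonneg'
  refine norm_le_of_forall (by positivity) fun a b hab z hz => ?_
  rw [zeroExt_lin, partialD_lin c d f.isCmBar.2.1 g.isCmBar.2.1 hab hz]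
  refine (abs_add_le _ _).trans ?_
  rw [abs_mul, abs_mul]
  have h1 := f.abs_partialD_le_norm hab hz
  have h2 := g.abs_partialD_le_norm hab hz
  gcongr

theorem eq_zero_of_norm_eq_zero (f : CmBar m H) (hf : ‖f‖ = 0) : f = 0 := by
  have h0 : ∀ z : closure (H : Set ℂ), (z : ℂ) ∈ H → f z = 0 := by
    intro z hz
    have := f.abs_partialD_le_norm (a := 0) (b := 0) (by omega) hz
    rw [hf] at this
    have h2 : partialD 0 0 (zeroExt f) z = 0 := abs_nonpos_iff.1 this
    simpa [partialD, zeroExt] using h2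
  have hd : Dense {z : closure (H : Set ℂ) | (z : ℂ) ∈ H} := by
    intro z
    rw [closure_subtype]
    have : (Subtype.val '' {z : closure (H : Set ℂ) | (z : ℂ) ∈ H}) = (H : Set ℂ) := by
      ext w
      constructor
      · rintro ⟨x, hx, rfl⟩; exact hx
      · intro hw; exact ⟨⟨w, subset_closure hw⟩, hw, rfl⟩
    rw [this]; exact z.2
  have : f.toFun = 0 := Continuous.ext_on hd f.isCmBar.1 continuous_zero (fun z hz => h0 z hz)
  exact Subtype.ext this

noncomputable instance instNormedAddCommGroup : NormedAddCommGroup (CmBar m H) :=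
  AddGroupNorm.toNormedAddCommGroup
    { toFun := fun f => ‖f‖
      map_zero' := by
        have h := norm_lin_le 0 0 (0 : CmBar m H) 0
        simp only [smul_zero, add_zero, abs_zero, zero_mul] at h
        exact le_antisymm h (norm_nonneg' _)
      add_le' := fun f g => by simpa using norm_lin_le 1 1 f g
      neg' := fun f => by
        have key : ∀ f : CmBar m H, ‖-f‖ ≤ ‖f‖ := fun f => by
          simpa using norm_lin_le (-1) 0 f f
        exact le_antisymm (key f) (by simpa using key (-f))
      eq_zero_of_map_eq_zero' := eq_zero_of_norm_eq_zero }

noncomputable instance instNormedSpace : NormedSpace ℝ (CmBar m H) where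
  norm_smul_le c f := by
    have h := norm_lin_le c 0 f f
    simp only [zero_smul, add_zero, abs_zero, zero_mul] at h
    exact h

end CmBar

/-- `(Λ_s f)(z) = ∑_{β ∈ B} |θ_β'(z)|^s f(θ_β(z))`. -/
noncomputable def transferSum (s : ℝ) (B : Finset ℂ) (f : ℂ → ℝ) (z : ℂ) : ℝ :=
  ∑ β ∈ B, ‖deriv (mobiusTheta β) z‖ ^ s * f (mobiusTheta β z)

/-- `v` is a strictly positive eigenvector of the bounded operator `Λ` on `C^m`. -/
def IsPositiveEigenvector {m : ℕ} {H : Opens ℂ} (Λ : CmBar m H →L[ℝ] CmBar m H)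
    (v : CmBar m H) : Prop :=
  (∀ z, 0 < v z) ∧
    ∃ r : ℝ, Module.End.HasEigenvector (Λ : CmBar m H →ₗ[ℝ] CmBar m H) r v

/-! The eigenvector is a superposition v(z) = ∫ |z + δ|^(-2s) dμ(δ) of translated kernels, with δ in
a compact set K of the half-plane Re δ ≥ γ. Since |θ_β'(z)| = |z + β|^(-2), the identity
`normKernel_intertwine` turns the action of Λ_s on z into the action on δ of the operator (T g)(δ) =
|δ|^(-2s) ∑ g(β + 1/δ) on C(K). Hence v is an eigenfunction as soon as μ is an eigenmeasure of the
adjoint of T. For a positive operator such a μ comes from Hahn-Banach and Riesz-Markov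
(`exists_positive_eigenfunctional`, `exists_eigenmeasure`).

This formula yields smoothness and all the estimates. The poles -δ satisfy Re(-δ) ≤ -1, so v is
smooth on Re z > -1, a neighbourhood of the closure of H, and derivatives pass under the integral.
Bounds lo ≤ h/g ≤ hi with g > 0 survive integration (`translateIntegral_div_mem_Icc`), so it is
enough to bound D^α k / k for the single kernel k(w) = |w|^(-2s) on Re w ≥ γ. Writing w = x + iy and
p = x²/(x² + y²), the quotient of order j is x^(-j) times a function of p and y/x, and the stated
constants come from elementary polynomial inequalities.

Uniqueness is a maximum principle. For positive eigenfunctions v and w, positivity of Λ_s at the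
extrema of w/v forces equal eigenvalues and makes the sets of maximum points and of minimum points
invariant under θ_β. As θ_β strictly decreases distances, a closest pair from these two sets must
coincide, so w/v is constant.

Boundedness of Λ_s on C^m follows from the Leibniz and chain rules, carried out with explicit
constants on the recursive predicate `HasBddExt`. -/

/-- The partial derivatives of `f` up to order `m` exist on `H`, are bounded by `C` there and
extend continuously to the closure of `H`. -/
def HasBddExt (H : Opens ℂ) (C : ℝ) : ℕ → (ℂ → ℝ) → Prop
  | 0, f => (∃ g : ℂ → ℝ, ContinuousOn g (closure (H : Set ℂ)) ∧ EqOn f g H) ∧ ∀ z ∈ H, |f z| ≤ C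
  | m + 1, f => ((∃ g : ℂ → ℝ, ContinuousOn g (closure (H : Set ℂ)) ∧ EqOn f g H) ∧
      ∀ z ∈ H, |f z| ≤ C) ∧ DifferentiableOn ℝ f H ∧
      HasBddExt H C m (partialX f) ∧ HasBddExt H C m (partialY f)

/-! ### Calculus of the two partial derivatives on open sets. -/

section PartialDerivatives

theorem fderiv_eq_partial (f : ℂ → ℝ) (z w : ℂ) :
    fderiv ℝ f z w = partialX f z * w.re + partialY f z * w.im := by
  have : w = w.re • (1 : ℂ) + w.im • Complex.I := by
    simp [Complex.re_add_im]
  conv_lhs => rw [this]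
  rw [map_add, map_smul, map_smul, smul_eq_mul, smul_eq_mul, partialX, partialY]
  ring

theorem partialD_succ_left (a b : ℕ) (f : ℂ → ℝ) :
    partialD (a + 1) b f = partialX (partialD a b f) := by
  simp only [partialD, Function.iterate_succ_apply']

theorem eqOn_partialX {U : Opens ℂ} {f g : ℂ → ℝ} (h : EqOn f g U) :
    EqOn (partialX f) (partialX g) U := eqOn_dir 1 h

theorem eqOn_partialY {U : Opens ℂ} {f g : ℂ → ℝ} (h : EqOn f g U) :
    EqOn (partialY f) (partialY g) U := eqOn_dir Complex.I h

theorem eqOn_partialD {U : Opens ℂ} (a b : ℕ) {f g : ℂ → ℝ} (h : EqOn f g U) :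
    EqOn (partialD a b f) (partialD a b g) U := by
  have hb : EqOn (partialY^[b] f) (partialY^[b] g) U := by
    induction b with
    | zero => exact h
    | succ b ih => simp only [Function.iterate_succ_apply']; exact eqOn_partialY ih
  induction a with
  | zero => exact hb
  | succ a ih => simp only [partialD_succ_left]; exact eqOn_partialX ih

theorem contDiffOn_partialX {U : Opens ℂ} {n : ℕ} {f : ℂ → ℝ}
    (hf : ContDiffOn ℝ (n + 1 : ℕ) f U) : ContDiffOn ℝ n (partialX f) U := contDiffOn_dir 1 hf

theorem contDiffOn_partialY {U : Opens ℂ} {n : ℕ} {f : ℂ → ℝ}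
    (hf : ContDiffOn ℝ (n + 1 : ℕ) f U) : ContDiffOn ℝ n (partialY f) U :=
  contDiffOn_dir Complex.I hf

theorem contDiffOn_partialD {U : Opens ℂ} {n a b : ℕ} {f : ℂ → ℝ}
    (hf : ContDiffOn ℝ (n + a + b : ℕ) f U) : ContDiffOn ℝ n (partialD a b f) U := by
  obtain ⟨p, -, -⟩ := iterate_dir (H := U) Complex.I partialY (fun _ _ => rfl) b (n + a) 1 1
    hf hf (fun _ _ => rfl)
  obtain ⟨q, -, -⟩ := iterate_dir (H := U) 1 partialX (fun _ _ => rfl) a n 1 1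
    p p (fun _ _ => rfl)
  exact q

theorem partialY_partialX_comm {U : Opens ℂ} {f : ℂ → ℝ} (hf : ContDiffOn ℝ 2 f U) :
    EqOn (partialY (partialX f)) (partialX (partialY f)) U := by
  intro z hz
  have hfz : ContDiffAt ℝ 2 f z := hf.contDiffAt (U.isOpen.mem_nhds hz)
  have hsymm : IsSymmSndFDerivAt ℝ f z := hfz.isSymmSndFDerivAt (by simp)
  have hd : DifferentiableAt ℝ (fderiv ℝ f) z :=
    (hfz.fderiv_right (m := 1) (by norm_num)).differentiableAt (by norm_num)
  have key : ∀ e : ℂ, fderiv ℝ (fun w => fderiv ℝ f w e) z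
      = (fderiv ℝ (fderiv ℝ f) z).flip e := by
    intro e
    rw [fderiv_clm_apply hd (differentiableAt_const e)]
    simp
  change fderiv ℝ (fun w => fderiv ℝ f w 1) z Complex.I
    = fderiv ℝ (fun w => fderiv ℝ f w Complex.I) z 1
  rw [key, key]
  exact hsymm.eq _ _

/-- In `partialD` the y-derivatives are taken before the x-derivatives, so a further y-derivative
has to be moved inwards through them by symmetry of second derivatives. -/
theorem partialY_partialD {U : Opens ℂ} {a b : ℕ} {f : ℂ → ℝ}
    (hf : ContDiffOn ℝ (a + b + 1 : ℕ) f U) :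
    EqOn (partialY (partialD a b f)) (partialD a (b + 1) f) U := by
  induction a with
  | zero => 
    simp only [partialD, Function.iterate_zero, id, Function.iterate_succ_apply']
    exact fun _ _ => rfl
  | succ a ih =>
    rw [partialD_succ_left, partialD_succ_left]
    have h2 : ContDiffOn ℝ 2 (partialD a b f) U :=
      contDiffOn_partialD (n := 2) (hf.of_le (by exact_mod_cast (by omega)))
    exact (partialY_partialX_comm h2).trans
      (eqOn_partialX (ih (hf.of_le (by exact_mod_cast (by omega)))))

theorem contDiffOn_succ_of_partial {U : Opens ℂ} {n : ℕ} {f : ℂ → ℝ}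
    (hd : DifferentiableOn ℝ f U) (hx : ContDiffOn ℝ n (partialX f) U)
    (hy : ContDiffOn ℝ n (partialY f) U) : ContDiffOn ℝ (n + 1 : ℕ) f U := by
  have h : fderiv ℝ f = fun z => partialX f z • Complex.reCLM + partialY f z • Complex.imCLM := by
    funext z
    ext1 w
    simp [fderiv_eq_partial f z w]
  push_cast
  rw [contDiffOn_succ_iff_fderiv_of_isOpen U.isOpen]
  refine ⟨hd, by simp, ?_⟩
  rw [h]
  exact (hx.smul contDiffOn_const).add (hy.smul contDiffOn_const)

end PartialDerivatives

/-! ### Stability of derivative bounds under sums, products and composition. -/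

namespace HasBddExt

variable {H : Opens ℂ}

theorem base {C : ℝ} {m : ℕ} {f : ℂ → ℝ} (hf : HasBddExt H C m f) : HasBddExt H C 0 f := by
  cases m with
  | zero => exact hf
  | succ m => exact hf.1

theorem congr {C : ℝ} {m : ℕ} {f g : ℂ → ℝ} (hf : HasBddExt H C m f) (h : EqOn g f H) :
    HasBddExt H C m g := by
  induction m generalizing f g with
  | zero =>
    obtain ⟨⟨p, hp, hfp⟩, hb⟩ := hf
    exact ⟨⟨p, hp, h.trans hfp⟩, fun z hz => by rw [h hz]; exact hb z hz⟩
  | succ m ih =>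
    obtain ⟨⟨⟨p, hp, hfp⟩, hb⟩, hd, hx, hy⟩ := hf
    exact ⟨⟨⟨p, hp, h.trans hfp⟩, fun z hz => by rw [h hz]; exact hb z hz⟩, hd.congr h,
      ih hx (eqOn_partialX h), ih hy (eqOn_partialY h)⟩

theorem of_succ {C : ℝ} {m : ℕ} {f : ℂ → ℝ} (hf : HasBddExt H C (m + 1) f) :
    HasBddExt H C m f := by
  induction m generalizing f with
  | zero => exact hf.1
  | succ m ih => exact ⟨hf.1, hf.2.1, ih hf.2.2.1, ih hf.2.2.2⟩

theorem mono {C D : ℝ} (hCD : C ≤ D) {m : ℕ} {f : ℂ → ℝ} (hf : HasBddExt H C m f) :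
    HasBddExt H D m f := by
  induction m generalizing f with
  | zero => exact ⟨hf.1, fun z hz => (hf.2 z hz).trans hCD⟩
  | succ m ih =>
    exact ⟨⟨hf.1.1, fun z hz => (hf.1.2 z hz).trans hCD⟩, hf.2.1, ih hf.2.2.1, ih hf.2.2.2⟩

theorem fderiv_add_eqOn {f g : ℂ → ℝ} (hf : DifferentiableOn ℝ f H)
    (hg : DifferentiableOn ℝ g H) (e : ℂ) :
    EqOn (fun z => fderiv ℝ (f + g) z e) ((fun z => fderiv ℝ f z e) + fun z => fderiv ℝ g z e)
      H := by
  intro z hz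
  have h1 := hf.differentiableAt (H.isOpen.mem_nhds hz)
  have h2 := hg.differentiableAt (H.isOpen.mem_nhds hz)
  simp [fderiv_add h1 h2]

theorem add {C D : ℝ} {m : ℕ} {f g : ℂ → ℝ} (hf : HasBddExt H C m f) (hg : HasBddExt H D m g) :
    HasBddExt H (C + D) m (f + g) := by
  have key : ∀ {f g : ℂ → ℝ}, HasBddExt H C 0 f → HasBddExt H D 0 g →
      HasBddExt H (C + D) 0 (f + g) := by
    rintro f g ⟨⟨p, hp, hfp⟩, hb⟩ ⟨⟨q, hq, hgq⟩, hc⟩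
    refine ⟨⟨p + q, hp.add hq, fun z hz => ?_⟩, fun z hz => ?_⟩
    · simp [hfp hz, hgq hz]
    · exact (abs_add_le _ _).trans (add_le_add (hb z hz) (hc z hz))
  induction m generalizing f g with
  | zero => exact key hf hg
  | succ m ih =>
    exact ⟨key hf.base hg.base, hf.2.1.add hg.2.1,
      (ih hf.2.2.1 hg.2.2.1).congr (fderiv_add_eqOn hf.2.1 hg.2.1 1),
      (ih hf.2.2.2 hg.2.2.2).congr (fderiv_add_eqOn hf.2.1 hg.2.1 Complex.I)⟩

theorem fderiv_mul_eqOn {f g : ℂ → ℝ} (hf : DifferentiableOn ℝ f H)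
    (hg : DifferentiableOn ℝ g H) (e : ℂ) :
    EqOn (fun z => fderiv ℝ (f * g) z e)
      ((fun z => fderiv ℝ f z e) * g + f * fun z => fderiv ℝ g z e) H := by
  intro z hz
  have h1 := hf.differentiableAt (H.isOpen.mem_nhds hz)
  have h2 := hg.differentiableAt (H.isOpen.mem_nhds hz)
  simp [fderiv_mul h1 h2]
  ring

/-- Each application of the Leibniz rule doubles the number of products, which gives the factor `2 ^
m`. -/
theorem mul {C D : ℝ} (hC : 0 ≤ C) (hD : 0 ≤ D) {m : ℕ} {f g : ℂ → ℝ}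
    (hf : HasBddExt H C m f) (hg : HasBddExt H D m g) :
    HasBddExt H (2 ^ m * (C * D)) m (f * g) := by
  have hCD : 0 ≤ C * D := mul_nonneg hC hD
  have key : ∀ {f g : ℂ → ℝ}, HasBddExt H C 0 f → HasBddExt H D 0 g →
      HasBddExt H (C * D) 0 (f * g) := by
    rintro f g ⟨⟨p, hp, hfp⟩, hb⟩ ⟨⟨q, hq, hgq⟩, hc⟩
    refine ⟨⟨p * q, hp.mul hq, fun z hz => ?_⟩, fun z hz => ?_⟩
    · simp [hfp hz, hgq hz]
    · rw [Pi.mul_apply, abs_mul]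
      exact mul_le_mul (hb z hz) (hc z hz) (abs_nonneg _) hC
  induction m generalizing f g with
  | zero => simpa using key hf hg
  | succ m ih =>
    have e : (2 : ℝ) ^ (m + 1) * (C * D) = 2 ^ m * (C * D) + 2 ^ m * (C * D) := by ring
    have hle : C * D ≤ 2 ^ (m + 1) * (C * D) :=
      le_mul_of_one_le_left hCD (one_le_pow₀ (by norm_num))
    refine ⟨mono hle (key hf.base hg.base), hf.2.1.mul hg.2.1, ?_, ?_⟩
    · rw [e]
      exact ((ih hf.2.2.1 hg.of_succ).add (ih hf.of_succ hg.2.2.1)).congr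
        (fderiv_mul_eqOn hf.2.1 hg.2.1 1)
    · rw [e]
      exact ((ih hf.2.2.2 hg.of_succ).add (ih hf.of_succ hg.2.2.2)).congr
        (fderiv_mul_eqOn hf.2.1 hg.2.1 Complex.I)

theorem zero (m : ℕ) : HasBddExt H 0 m 0 := by
  induction m with
  | zero => exact ⟨⟨0, continuousOn_const, fun _ _ => rfl⟩, by simp⟩
  | succ m ih =>
    have hx : partialX (0 : ℂ → ℝ) = 0 := partialD_zero_fun 1 0
    have hy : partialY (0 : ℂ → ℝ) = 0 := partialD_zero_fun 0 1
    refine ⟨⟨⟨0, continuousOn_const, fun _ _ => rfl⟩, by simp⟩, ?_, ?_, ?_⟩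
    · exact differentiableOn_const (0 : ℝ)
    · rw [hx]; exact ih
    · rw [hy]; exact ih

theorem sum {ι : Type*} (S : Finset ι) {C : ι → ℝ} {m : ℕ} {f : ι → ℂ → ℝ}
    (hf : ∀ i ∈ S, HasBddExt H (C i) m (f i)) :
    HasBddExt H (∑ i ∈ S, C i) m (∑ i ∈ S, f i) := by
  classical
  induction S using Finset.induction_on with
  | empty => simpa using zero m
  | insert i S hi ih =>
    rw [Finset.sum_insert hi, Finset.sum_insert hi]
    exact (hf i (Finset.mem_insert_self i S)).add
      (ih fun j hj => hf j (Finset.mem_insert_of_mem hj))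

theorem of_contDiffOn (hb : Bornology.IsBounded (H : Set ℂ)) {U : Opens ℂ}
    (hU : closure (H : Set ℂ) ⊆ U) (m : ℕ) {f : ℂ → ℝ} (hf : ∀ n : ℕ, ContDiffOn ℝ n f U) :
    ∃ C, 0 ≤ C ∧ HasBddExt H C m f := by
  have hcpt : IsCompact (closure (H : Set ℂ)) := hb.isCompact_closure
  have hHU : (H : Set ℂ) ⊆ U := subset_closure.trans hU
  have key : ∀ {f : ℂ → ℝ}, (∀ n : ℕ, ContDiffOn ℝ n f U) → ∃ C, 0 ≤ C ∧ HasBddExt H C 0 f := by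
    intro f hf
    have hc : ContinuousOn f (closure (H : Set ℂ)) := (hf 0).continuousOn.mono hU
    obtain ⟨C, hC⟩ := hcpt.exists_bound_of_continuousOn hc
    exact ⟨max C 0, le_max_right _ _, ⟨f, hc, fun _ _ => rfl⟩,
      fun z hz => (hC z (subset_closure hz)).trans (le_max_left _ _)⟩
  induction m generalizing f with
  | zero => exact key hf
  | succ m ih =>
    obtain ⟨C₀, h₀, h0⟩ := key hf
    obtain ⟨C₁, h₁, h1⟩ := ih fun n => contDiffOn_partialX (hf (n + 1))
    obtain ⟨C₂, h₂, h2⟩ := ih fun n => contDiffOn_partialY (hf (n + 1))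
    refine ⟨C₀ + C₁ + C₂, by positivity, mono (by linarith) h0, ?_, mono (by linarith) h1,
      mono (by linarith) h2⟩
    exact ((hf 1).differentiableOn (by norm_num)).mono hHU

theorem fderiv_comp_eqOn {U : Opens ℂ} (hHU : (H : Set ℂ) ⊆ U) {θ : ℂ → ℂ}
    (hθ : DifferentiableOn ℝ θ U) (hmaps : MapsTo θ H H) {f : ℂ → ℝ}
    (hf : DifferentiableOn ℝ f H) (e : ℂ) :
    EqOn (fun z => fderiv ℝ (f ∘ θ) z e)
      ((partialX f ∘ θ) * (fun z => fderiv ℝ (fun w => (θ w).re) z e)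
        + (partialY f ∘ θ) * fun z => fderiv ℝ (fun w => (θ w).im) z e) H := by
  intro z hz
  have h1 := hf.differentiableAt (H.isOpen.mem_nhds (hmaps hz))
  have h2 := hθ.differentiableAt (U.isOpen.mem_nhds (hHU hz))
  have hre : fderiv ℝ (fun w => (θ w).re) z e = (fderiv ℝ θ z e).re := by
    have := (Complex.reCLM.hasFDerivAt.comp z h2.hasFDerivAt).fderiv
    exact congrArg (fun L => L e) this
  have him : fderiv ℝ (fun w => (θ w).im) z e = (fderiv ℝ θ z e).im := by
    have := (Complex.imCLM.hasFDerivAt.comp z h2.hasFDerivAt).fderiv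
    exact congrArg (fun L => L e) this
  simp only [Pi.add_apply, Pi.mul_apply, Function.comp_apply, hre, him]
  rw [fderiv_comp z h1 h2, ContinuousLinearMap.comp_apply, fderiv_eq_partial]

/-- The point is that `K` depends on `θ` and `m` but not on `f`: this is what bounds the transfer
operator. The chain rule expresses the derivatives of `f ∘ θ` by those of `f` at `θ`, multiplied by
derivatives of `θ` that are bounded on the compact closure. -/
theorem comp (hb : Bornology.IsBounded (H : Set ℂ)) {U : Opens ℂ}
    (hU : closure (H : Set ℂ) ⊆ U) {θ : ℂ → ℂ} (hθ : ∀ n : ℕ, ContDiffOn ℝ n θ U)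
    (hmaps : MapsTo θ H H) (m : ℕ) :
    ∃ K, 0 ≤ K ∧ ∀ (C : ℝ) (f : ℂ → ℝ), 0 ≤ C → HasBddExt H C m f →
      HasBddExt H (K * C) m (f ∘ θ) := by
  have hHU : (H : Set ℂ) ⊆ U := subset_closure.trans hU
  have hcont : ContinuousOn θ (closure (H : Set ℂ)) := (hθ 0).continuousOn.mono hU
  have hclos : MapsTo θ (closure (H : Set ℂ)) (closure (H : Set ℂ)) := hmaps.closure_of_continuousOn hcont
  have hdiff : DifferentiableOn ℝ θ U := (hθ 1).differentiableOn (by norm_num)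
  have key : ∀ {C : ℝ} {f : ℂ → ℝ}, HasBddExt H C 0 f → HasBddExt H C 0 (f ∘ θ) := by
    rintro C f ⟨⟨p, hp, hfp⟩, hb⟩
    exact ⟨⟨p ∘ θ, hp.comp hcont hclos, fun z hz => hfp (hmaps hz)⟩, fun z hz => hb _ (hmaps hz)⟩
  have hre : ∀ n : ℕ, ContDiffOn ℝ n (fun w => (θ w).re) U := fun n =>
    Complex.reCLM.contDiff.comp_contDiffOn (hθ n)
  have him : ∀ n : ℕ, ContDiffOn ℝ n (fun w => (θ w).im) U := fun n =>
    Complex.imCLM.contDiff.comp_contDiffOn (hθ n)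
  induction m with
  | zero => exact ⟨1, zero_le_one, fun C f _ hf => by simpa using key hf⟩
  | succ m ih =>
    obtain ⟨K, hK, hcomp⟩ := ih
    obtain ⟨A, hA, hA'⟩ := of_contDiffOn hb hU m fun n => contDiffOn_partialX (hre (n + 1))
    obtain ⟨B, hB, hB'⟩ := of_contDiffOn hb hU m fun n => contDiffOn_partialX (him (n + 1))
    obtain ⟨A₂, hA₂, hA₂'⟩ := of_contDiffOn hb hU m fun n => contDiffOn_partialY (hre (n + 1))
    obtain ⟨B₂, hB₂, hB₂'⟩ := of_contDiffOn hb hU m fun n => contDiffOn_partialY (him (n + 1))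
    refine ⟨1 + 2 ^ m * (K * (A + B + A₂ + B₂)), by positivity, fun C f hC hf => ?_⟩
    have hx := hcomp C _ hC hf.2.2.1
    have hy := hcomp C _ hC hf.2.2.2
    have hKC : 0 ≤ K * C := mul_nonneg hK hC
    have e : ∀ S T : ℝ, 0 ≤ S → 0 ≤ T → S + T ≤ A + B + A₂ + B₂ →
        2 ^ m * (K * C * S) + 2 ^ m * (K * C * T)
          ≤ (1 + 2 ^ m * (K * (A + B + A₂ + B₂))) * C := by
      intro S T _ _ hST
      have : 2 ^ m * (K * C) * (S + T) ≤ 2 ^ m * (K * C) * (A + B + A₂ + B₂) := by gcongr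
      nlinarith
    refine ⟨mono ?_ (key hf.base), ?_, ?_, ?_⟩
    · exact le_mul_of_one_le_left hC (by
        have : 0 ≤ 2 ^ m * (K * (A + B + A₂ + B₂)) := by positivity
        linarith)
    · exact hf.2.1.comp (hdiff.mono hHU) hmaps
    · exact mono (e A B hA hB (by linarith)) (((mul hKC hA hx hA').add (mul hKC hB hy hB')).congr
        (fderiv_comp_eqOn hHU hdiff hmaps hf.2.1 1))
    · exact mono (e A₂ B₂ hA₂ hB₂ (by linarith))
        (((mul hKC hA₂ hx hA₂').add (mul hKC hB₂ hy hB₂')).congr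
          (fderiv_comp_eqOn hHU hdiff hmaps hf.2.1 Complex.I))

theorem contDiffOn {C : ℝ} {m : ℕ} {f : ℂ → ℝ} (hf : HasBddExt H C m f) :
    ContDiffOn ℝ m f H := by
  induction m generalizing f with
  | zero =>
    obtain ⟨⟨g, hg, hfg⟩, -⟩ := hf
    simpa using (hg.mono subset_closure).congr hfg
  | succ m ih => exact contDiffOn_succ_of_partial hf.2.1 (ih hf.2.2.1) (ih hf.2.2.2)

theorem partialD {C : ℝ} {a b m : ℕ} {f : ℂ → ℝ} (hf : HasBddExt H C (m + a + b) f) :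
    HasBddExt H C m (partialD a b f) := by
  have hY : HasBddExt H C (m + a) (partialY^[b] f) := by
    induction b generalizing f with
    | zero => exact hf
    | succ b ih => exact ih hf.2.2.2
  clear hf
  unfold _root_.partialD
  generalize partialY^[b] f = g at hY
  induction a generalizing g with
  | zero => exact hY
  | succ a ih => exact ih (partialX g) hY.2.2.1

theorem of_le {C : ℝ} {m n : ℕ} (h : n ≤ m) {f : ℂ → ℝ} (hf : HasBddExt H C m f) :
    HasBddExt H C n f := by
  induction m, h using Nat.le_induction with
  | base => exact hf
  | succ m _ ih => exact ih hf.of_succ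

theorem isCmBar (hb : Bornology.IsBounded (H : Set ℂ)) {C : ℝ} {m : ℕ}
    {F : closure (H : Set ℂ) → ℝ} (hF : Continuous F) (h : HasBddExt H C m (zeroExt F)) :
    IsCmBar m H F := by
  refine ⟨hF, h.contDiffOn, fun a b hab => ?_⟩
  obtain ⟨⟨g, hg, hfg⟩, -⟩ := HasBddExt.partialD (m := 0) (a := a) (b := b) (h.of_le (by omega))
  have : CompactSpace (closure (H : Set ℂ)) := isCompact_iff_compactSpace.1 hb.isCompact_closure
  exact ⟨BoundedContinuousFunction.mkOfCompact ⟨_, hg.domRestrict⟩, fun z hz => (hfg hz).symm⟩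

theorem of_isCmBar {C : ℝ} {m : ℕ} {F : closure (H : Set ℂ) → ℝ} (hF : IsCmBar m H F)
    (hC : ∀ a b : ℕ, a + b ≤ m → ∀ z ∈ H, |_root_.partialD a b (zeroExt F) z| ≤ C) :
    HasBddExt H C m (zeroExt F) := by
  have key : ∀ a b : ℕ, a + b ≤ m → HasBddExt H C 0 (_root_.partialD a b (zeroExt F)) := by
    intro a b hab
    obtain ⟨g, hg⟩ := hF.2.2 a b hab
    refine ⟨⟨zeroExt g, ?_, fun z hz => ?_⟩, hC a b hab⟩
    · rw [continuousOn_iff_continuous_domRestrict]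
      convert g.continuous using 1
      funext z
      simp [zeroExt]
    · rw [← hg ⟨z, subset_closure hz⟩ hz, zeroExt, dif_pos (subset_closure hz)]
  -- `HasBddExt` differentiates from the outside, so the induction is on the remaining order `k`,
  -- for all derivatives already taken.
  suffices h : ∀ k a b : ℕ, k + a + b ≤ m →
      HasBddExt H C k (_root_.partialD a b (zeroExt F)) from h m 0 0 (by omega)
  intro k
  induction k with
  | zero => intro a b hab; exact key a b (by omega)
  | succ k ih =>
    intro a b hab
    have hsm : ContDiffOn ℝ (1 + a + b : ℕ) (zeroExt F) H :=
      hF.2.1.of_le (by exact_mod_cast (by omega))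
    refine ⟨key a b (by omega), ?_, ?_, ?_⟩
    · exact (contDiffOn_partialD hsm).differentiableOn (by norm_num)
    · rw [← partialD_succ_left]; exact ih (a + 1) b (by omega)
    · exact (ih a (b + 1) (by omega)).congr
        (partialY_partialD (by rw [show a + b + 1 = 1 + a + b by omega]; exact hsm))

end HasBddExt

/-! ### Eigenmeasures of positive operators on C(X). -/

section PositiveOperators

variable {X : Type*} [TopologicalSpace X] [CompactSpace X] [Nonempty X]

/-- The adjoint of a positive operator on `C(X)` has a positive eigenfunctional. -/
theorem exists_positive_eigenfunctional (T : C(X, ℝ) →ₗ[ℝ] C(X, ℝ))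
    (hT : ∀ g : C(X, ℝ), (∀ x, 0 ≤ g x) → ∀ x, 0 ≤ T g x) (hT1 : ∀ x, 0 < T 1 x) :
    ∃ (φ : C(X, ℝ) →L[ℝ] ℝ) (r : ℝ), 0 < r ∧ 0 < φ 1 ∧
      (∀ g : C(X, ℝ), (∀ x, 0 ≤ g x) → 0 ≤ φ g) ∧ ∀ g, φ (T g) = r * φ g := by
  -- A Collatz-Wielandt characterisation: the infimum of these `t` will be the eigenvalue.
  let S : Set ℝ := {t | ∃ p : C(X, ℝ), (∀ x, 0 < p x) ∧ ∀ x, T p x ≤ t * p x}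
  have hS : S.Nonempty := ⟨‖T 1‖, 1, fun x => by simp, fun x => by
    simpa using (le_abs_self _).trans ((T 1).norm_coe_le_norm x)⟩
  have hSb : BddBelow S := by
    refine ⟨0, ?_⟩
    rintro t ⟨p, hp, htp⟩
    obtain ⟨x⟩ := ‹Nonempty X›
    have h0 := (hT p (fun y => (hp y).le) x).trans (htp x)
    exact nonneg_of_mul_nonneg_left h0 (hp x)
  set r := sInf S with hr
  have hdisj : ∀ g : C(X, ℝ), ¬ ∀ x, T g x - r * g x < 0 := by
    intro g hg
    obtain ⟨x₀, -, hx₀⟩ := isCompact_univ.exists_isMaxOn univ_nonempty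
      (T g - r • g : C(X, ℝ)).continuous.continuousOn
    set ε : ℝ := -(T g x₀ - r * g x₀) with hε
    have hε0 : 0 < ε := by have := hg x₀; linarith
    have hle : ∀ x, T g x ≤ r * g x - ε := by
      intro x
      have := hx₀ (mem_univ x)
      simp only [ContinuousMap.sub_apply, ContinuousMap.smul_apply, smul_eq_mul,
        mem_ofPred_eq] at this
      linarith
    have hgn : ∀ x, |g x| ≤ ‖g‖ := fun x => g.norm_coe_le_norm x
    have hN : 0 < ‖g‖ + 1 := by positivity
    -- For positive `g` the gap `ε` would allow a value smaller than the infimum `r`.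
    by_cases hpos : ∀ x, 0 < g x
    · have hmem : r - ε / (‖g‖ + 1) ∈ S := by
        refine ⟨g, hpos, fun x => (hle x).trans ?_⟩
        have h1 : g x ≤ ‖g‖ + 1 := (le_abs_self _).trans ((hgn x).trans (by linarith))
        have h2 : ε / (‖g‖ + 1) * g x ≤ ε / (‖g‖ + 1) * (‖g‖ + 1) := by gcongr
        rw [div_mul_cancel₀ _ hN.ne'] at h2
        linarith
      have h1 := csInf_le hSb hmem
      have h2 : 0 < ε / (‖g‖ + 1) := by positivity
      linarith
    · push Not at hpos
      obtain ⟨y, hy⟩ := hpos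
      obtain ⟨t, ⟨p, hp, htp⟩, ht⟩ := exists_lt_of_csInf_lt hS
        (show sInf S < r + ε / (‖g‖ + 1) by
          have : 0 < ε / (‖g‖ + 1) := by positivity
          linarith)
      -- Otherwise `g` is compared with a nearly optimal `p`. If `c` is the minimum of `g / p`,
      -- attained at `z`, then `c ≤ 0` and `T g z ≥ c * T p z ≥ t * g z`. Together with `T g z ≤ r *
      -- g z - ε` this contradicts the closeness of `t` to `r`.
      have hrt : r ≤ t := csInf_le hSb ⟨p, hp, htp⟩
      obtain ⟨z, -, hz⟩ := isCompact_univ.exists_isMinOn univ_nonempty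
        (f := fun x => g x / p x)
        (g.continuous.div p.continuous fun x => (hp x).ne').continuousOn
      set c := g z / p z with hc
      have hgz : g z = c * p z := by rw [hc, div_mul_cancel₀ _ (hp z).ne']
      have hmin : ∀ x, 0 ≤ (g - c • p) x := by
        intro x
        have h1 : c ≤ g x / p x := hz (mem_univ x)
        rw [le_div_iff₀ (hp x)] at h1
        simpa using h1
      have hc0 : c ≤ 0 := by
        have h1 : c ≤ g y / p y := hz (mem_univ y)
        exact h1.trans (div_nonpos_of_nonpos_of_nonneg hy (hp y).le)
      have h1 := hT _ hmin z
      rw [map_sub, map_smul, ContinuousMap.sub_apply, ContinuousMap.smul_apply, smul_eq_mul] at h1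
      have h2 : c * (t * p z) ≤ c * T p z := mul_le_mul_of_nonpos_left (htp z) hc0
      have h3 := hle z
      have h4 : ε ≤ (t - r) * (-g z) := by
        rw [hgz] at h3 ⊢
        nlinarith
      have h5 : (t - r) * (-g z) ≤ (t - r) * (‖g‖ + 1) := by
        have : -g z ≤ ‖g‖ + 1 := (neg_le_abs _).trans ((hgn z).trans (by linarith))
        have : 0 ≤ t - r := by linarith
        gcongr
      have h6 : (t - r) * (‖g‖ + 1) < ε := by
        rw [← lt_div_iff₀ hN]; linarith
      linarith
  let N : Set C(X, ℝ) := {h | ∀ x, h x < 0}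
  have hNo : IsOpen N := by
    have := ContinuousMap.isOpen_setOfPred_mapsTo (X := X) (Y := ℝ) isCompact_univ (isOpen_Iio (a := 0))
    convert this using 1
    ext h
    simp [N, MapsTo]
  have hNc : Convex ℝ N := by
    intro a ha b hb s t hs ht hst x
    have h1 := ha x
    have h2 := hb x
    simp only [ContinuousMap.add_apply, ContinuousMap.smul_apply, smul_eq_mul]
    rcases hs.eq_or_lt with rfl | hs
    · have : t = 1 := by linarith
      subst this; linarith
    · nlinarith
  let R : Submodule ℝ C(X, ℝ) := LinearMap.range (T - r • LinearMap.id)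
  -- By `hdisj` the range of `T - r` misses the open convex cone of strictly negative functions, so
  -- a functional separates them.
  obtain ⟨φ, u, h1, h2⟩ := geometric_hahn_banach_open (t := (R : Set C(X, ℝ))) hNc hNo R.convex (by
    rw [Set.disjoint_left]
    rintro _ hN' ⟨g, rfl⟩
    exact hdisj g hN')
  have hu : u ≤ 0 := by simpa using h2 0 R.zero_mem
  have hneg : ∀ h : C(X, ℝ), (∀ x, h x < 0) → φ h < 0 := fun h hh => (h1 h hh).trans_le hu
  have hφ1 : 0 < φ 1 := by
    have := hneg (-1) (fun x => by simp)
    rw [map_neg] at this; linarith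
  -- Small negative constants lie in `N` and `φ` is arbitrarily close to `0` on them, so the
  -- separating level is `0`.
  have hu0 : 0 ≤ u := by
    by_contra! hu0
    have hk : 0 < -u / (2 * φ 1) := by
      apply div_pos <;> linarith
    have := h1 (-(-u / (2 * φ 1)) • 1) (fun x => by simpa using hk)
    rw [map_smul, smul_eq_mul] at this
    have e : -(-u / (2 * φ 1)) * φ 1 = u / 2 := by field_simp
    rw [e] at this
    linarith
  have hφpos : ∀ g : C(X, ℝ), (∀ x, 0 ≤ g x) → 0 ≤ φ g := by
    intro g hg
    by_contra! hlt
    have hk : 0 < -φ g / φ 1 := div_pos (by linarith) hφ1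
    have := hneg (-g - (-φ g / φ 1) • 1) (fun x => by
      have := hg x
      simp only [ContinuousMap.sub_apply, ContinuousMap.neg_apply, ContinuousMap.smul_apply,
        ContinuousMap.one_apply, smul_eq_mul, mul_one]
      linarith)
    rw [map_sub, map_neg, map_smul, smul_eq_mul, div_mul_cancel₀ _ hφ1.ne'] at this
    linarith
  have heig : ∀ g, φ (T g) = r * φ g := by
    intro g
    have ha : (T - r • LinearMap.id : C(X, ℝ) →ₗ[ℝ] C(X, ℝ)) g ∈ R := ⟨g, rfl⟩
    have h3 := h2 _ ha
    -- A functional that is non-negative on a subspace vanishes there.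
    have h4 := h2 _ (R.neg_mem ha)
    simp only [LinearMap.sub_apply, LinearMap.smul_apply, LinearMap.id_apply, map_sub, map_neg,
      map_smul, smul_eq_mul] at h3 h4
    linarith
  refine ⟨φ, r, ?_, hφ1, hφpos, heig⟩
  obtain ⟨x₀, -, hx₀⟩ := isCompact_univ.exists_isMinOn univ_nonempty (T 1).continuous.continuousOn
  -- Positivity of `r` comes from applying `φ` to `T 1 ≥ (min T 1) • 1`.
  have h3 : 0 ≤ φ (T 1 - (T 1 x₀) • 1) := hφpos _ fun x => by
    have : T 1 x₀ ≤ T 1 x := hx₀ (mem_univ x)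
    simpa using this
  rw [map_sub, map_smul, heig, smul_eq_mul] at h3
  have h4 : 0 < T 1 x₀ * φ 1 := mul_pos (hT1 x₀) hφ1
  exact pos_of_mul_pos_left (by linarith : 0 < r * φ 1) hφ1.le

open MeasureTheory in
/-- The adjoint of a positive operator on `C(X)` has a finite non-zero eigenmeasure. -/
theorem exists_eigenmeasure [T2Space X] [MeasurableSpace X] [BorelSpace X]
    (T : C(X, ℝ) →ₗ[ℝ] C(X, ℝ))
    (hT : ∀ g : C(X, ℝ), (∀ x, 0 ≤ g x) → ∀ x, 0 ≤ T g x) (hT1 : ∀ x, 0 < T 1 x) :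
    ∃ (μ : Measure X) (r : ℝ), IsFiniteMeasure μ ∧ μ ≠ 0 ∧ 0 < r ∧
      ∀ g : C(X, ℝ), ∫ x, T g x ∂μ = r * ∫ x, g x ∂μ := by
  obtain ⟨φ, r, hr, hφ1, hφ, heig⟩ := exists_positive_eigenfunctional T hT hT1
  let Φ : CompactlySupportedContinuousMap X ℝ →ₚ[ℝ] ℝ :=
    { toFun := fun g => φ g.toContinuousMap
      map_add' := fun f g => φ.map_add _ _
      map_smul' := fun c f => φ.map_smul c _
      monotone' := fun f g hfg => by
        have h := hφ (g.toContinuousMap - f.toContinuousMap) fun x => sub_nonneg.2 (hfg x)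
        rw [map_sub] at h
        exact sub_nonneg.1 h }
  have hint : ∀ g : C(X, ℝ), ∫ x, g x ∂(RealRMK.rieszMeasure Φ) = φ g := fun g =>
    RealRMK.integral_rieszMeasure Φ (CompactlySupportedContinuousMap.continuousMapEquiv g)
  refine ⟨RealRMK.rieszMeasure Φ, r, CompactSpace.isFiniteMeasure, ?_, hr, fun g => ?_⟩
  · intro h0
    have := hint 1
    rw [h0, integral_zero_measure] at this
    linarith
  · rw [hint, hint, heig]

end PositiveOperators

/-! ### The kernel |w|^(-2s) and its pure derivatives up to order four. -/

/-- The half-plane `{z : c < Re z}`. -/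
def rightHalfPlane (c : ℝ) : Opens ℂ := ⟨{z | c < z.re}, isOpen_lt continuous_const Complex.continuous_re⟩

theorem mem_rightHalfPlane {c : ℝ} {z : ℂ} : z ∈ rightHalfPlane c ↔ c < z.re := Iff.rfl

/-- The function `w ↦ |w|^(-2s)`. -/
noncomputable def normKernel (s : ℝ) (w : ℂ) : ℝ := (w.re ^ 2 + w.im ^ 2) ^ (-s)

/-- For `j ≤ 4`, the `j`-th derivative in `x` of `(x² + b²)^(-s)`. -/
noncomputable def kernelDeriv (s : ℝ) (j : ℕ) (x b : ℝ) : ℝ :=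
  match j with
  | 0 => (x ^ 2 + b ^ 2) ^ (-s)
  | 1 => -(2 * s) * (x ^ 1 * (x ^ 2 + b ^ 2) ^ (-s - 1))
  | 2 => -(2 * s) * (x ^ 0 * (x ^ 2 + b ^ 2) ^ (-s - 1))
      + 4 * s * (s + 1) * (x ^ 2 * (x ^ 2 + b ^ 2) ^ (-s - 2))
  | 3 => 12 * s * (s + 1) * (x ^ 1 * (x ^ 2 + b ^ 2) ^ (-s - 2))
      + -(8 * s * (s + 1) * (s + 2)) * (x ^ 3 * (x ^ 2 + b ^ 2) ^ (-s - 3))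
  | _ => 12 * s * (s + 1) * (x ^ 0 * (x ^ 2 + b ^ 2) ^ (-s - 2))
      + -(48 * s * (s + 1) * (s + 2)) * (x ^ 2 * (x ^ 2 + b ^ 2) ^ (-s - 3))
      + 16 * s * (s + 1) * (s + 2) * (s + 3) * (x ^ 4 * (x ^ 2 + b ^ 2) ^ (-s - 4))

/-- Each term of `kernelDeriv` is a multiple of such a product. For `i = 0` the truncated exponent
`i - 1` is harmless, because its coefficient is zero. -/
theorem hasDerivAt_pow_mul_rpow {x b : ℝ} (h : 0 < x ^ 2 + b ^ 2) (i : ℕ) (t : ℝ) :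
    HasDerivAt (fun x : ℝ => x ^ i * (x ^ 2 + b ^ 2) ^ t)
      (i * (x ^ (i - 1) * (x ^ 2 + b ^ 2) ^ t)
        + 2 * t * (x ^ (i + 1) * (x ^ 2 + b ^ 2) ^ (t - 1))) x := by
  have h1 : HasDerivAt (fun x : ℝ => x ^ 2 + b ^ 2) (2 * x) x := by
    simpa using (hasDerivAt_pow 2 x).add_const (b ^ 2)
  have h2 := h1.rpow_const (p := t) (Or.inl h.ne')
  convert! (hasDerivAt_pow i x).mul h2 using 1
  ring

theorem hasDerivAt_kernelDeriv (s : ℝ) {x b : ℝ} (h : 0 < x ^ 2 + b ^ 2) {j : ℕ} (hj : j < 4) :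
    HasDerivAt (fun x => kernelDeriv s j x b) (kernelDeriv s (j + 1) x b) x := by
  have e1 : -s - 1 - 1 = -s - 2 := by ring
  have e2 : -s - 2 - 1 = -s - 3 := by ring
  have e3 : -s - 3 - 1 = -s - 4 := by ring
  have key := @hasDerivAt_pow_mul_rpow x b h
  interval_cases j
  · convert! key 0 (-s) using 1
    · funext x; simp [kernelDeriv]
    · simp [kernelDeriv]
  · convert! (key 1 (-s - 1)).const_mul (-(2 * s)) using 1
    simp only [kernelDeriv, e1]; norm_num; ring
  · convert! ((key 0 (-s - 1)).const_mul (-(2 * s))).add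
      ((key 2 (-s - 2)).const_mul (4 * s * (s + 1))) using 1
    simp only [kernelDeriv, e1, e2]; norm_num; ring
  · convert! ((key 1 (-s - 2)).const_mul (12 * s * (s + 1))).add
      ((key 3 (-s - 3)).const_mul (-(8 * s * (s + 1) * (s + 2)))) using 1
    simp only [kernelDeriv, e2, e3]; norm_num; ring

theorem sq_add_sq_pos_of_re_pos {w : ℂ} (hw : 0 < w.re) : 0 < w.re ^ 2 + w.im ^ 2 := by positivity

theorem normKernel_pos (s : ℝ) {w : ℂ} (hw : 0 < w.re) : 0 < normKernel s w :=
  Real.rpow_pos_of_pos (sq_add_sq_pos_of_re_pos hw) _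

theorem contDiffOn_normKernel (s : ℝ) (n : ℕ) :
    ContDiffOn ℝ n (normKernel s) (rightHalfPlane 0) := by
  have h : ContDiff ℝ n (fun w : ℂ => w.re ^ 2 + w.im ^ 2) :=
    (Complex.reCLM.contDiff.pow 2).add (Complex.imCLM.contDiff.pow 2)
  exact h.contDiffOn.rpow_const_of_ne fun w hw => (sq_add_sq_pos_of_re_pos hw).ne'

theorem partialX_eq_of_hasDerivAt {f : ℂ → ℝ} {z : ℂ} {d : ℝ} (hf : DifferentiableAt ℝ f z)
    (h : HasDerivAt (fun x : ℝ => f ⟨x, z.im⟩) d z.re) : partialX f z = d := by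
  have hl : HasDerivAt (fun x : ℝ => (⟨x, z.im⟩ : ℂ)) 1 z.re := by
    have := (Complex.ofRealCLM.hasDerivAt (x := z.re)).add_const (z.im * Complex.I)
    convert! this using 1
    funext x
    apply Complex.ext <;> simp
  have h1 := HasFDerivAt.comp_hasDerivAt (f := fun x : ℝ => (⟨x, z.im⟩ : ℂ)) z.re
    (hf.hasFDerivAt : HasFDerivAt f _ (⟨z.re, z.im⟩ : ℂ)) hl
  exact h1.unique h

theorem partialY_eq_of_hasDerivAt {f : ℂ → ℝ} {z : ℂ} {d : ℝ} (hf : DifferentiableAt ℝ f z)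
    (h : HasDerivAt (fun y : ℝ => f ⟨z.re, y⟩) d z.im) : partialY f z = d := by
  have hl : HasDerivAt (fun y : ℝ => (⟨z.re, y⟩ : ℂ)) Complex.I z.im := by
    have := ((Complex.ofRealCLM.hasDerivAt (x := z.im)).mul_const Complex.I).const_add (z.re : ℂ)
    convert! this using 1
    · funext x
      apply Complex.ext <;> simp
    · simp
  have h1 := HasFDerivAt.comp_hasDerivAt (f := fun y : ℝ => (⟨z.re, y⟩ : ℂ)) z.im
    (hf.hasFDerivAt : HasFDerivAt f _ (⟨z.re, z.im⟩ : ℂ)) hl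
  exact h1.unique h

theorem partialD_normKernel_left (s : ℝ) {j : ℕ} (hj : j ≤ 4) :
    EqOn (partialD j 0 (normKernel s)) (fun w => kernelDeriv s j w.re w.im)
      (rightHalfPlane 0) := by
  induction j with
  | zero => exact fun _ _ => rfl
  | succ j ih =>
    have ih := ih (by omega)
    intro z hz
    have hsm : ContDiffOn ℝ 1 (partialD j 0 (normKernel s)) (rightHalfPlane 0) :=
      contDiffOn_partialD (n := 1) (contDiffOn_normKernel s _)
    have hd := ((hsm.congr fun w hw => (ih hw).symm).differentiableOn (by norm_num)).differentiableAt
      ((rightHalfPlane 0).isOpen.mem_nhds hz)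
    rw [partialD_succ_left, eqOn_partialX ih hz]
    exact partialX_eq_of_hasDerivAt hd
      (hasDerivAt_kernelDeriv s (sq_add_sq_pos_of_re_pos hz) (by omega))

/-- The kernel is symmetric in the real and imaginary parts, so the formulas for x serve for y with
the arguments exchanged. -/
theorem partialD_normKernel_right (s : ℝ) {j : ℕ} (hj : j ≤ 4) :
    EqOn (partialD 0 j (normKernel s)) (fun w => kernelDeriv s j w.im w.re)
      (rightHalfPlane 0) := by
  induction j with
  | zero =>
    intro w _
    simp [partialD, normKernel, kernelDeriv, add_comm]
  | succ j ih =>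
    have ih := ih (by omega)
    intro z hz
    have hsm : ContDiffOn ℝ 1 (partialD 0 j (normKernel s)) (rightHalfPlane 0) :=
      contDiffOn_partialD (n := 1) (contDiffOn_normKernel s _)
    have hd := ((hsm.congr fun w hw => (ih hw).symm).differentiableOn (by norm_num)).differentiableAt
      ((rightHalfPlane 0).isOpen.mem_nhds hz)
    have e : partialD 0 (j + 1) (normKernel s) = partialY (partialD 0 j (normKernel s)) := by
      simp only [partialD, Function.iterate_succ_apply', Function.iterate_zero, id]
    rw [e, eqOn_partialY ih hz]
    exact partialY_eq_of_hasDerivAt hd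
      (hasDerivAt_kernelDeriv s (by rw [add_comm]; exact sq_add_sq_pos_of_re_pos hz) (by omega))

/-! ### Bounds for the quotients of the kernel derivatives by the kernel. -/

section Quotients

/-- The quotient of the `j`-th derivative by the kernel is a polynomial in `x` and
`ρ = 1 / (x² + b²)`. -/
theorem kernelDeriv_eq {x b : ℝ} (h : 0 < x ^ 2 + b ^ 2) (s : ℝ) :
    kernelDeriv s 1 x b = -(2 * s) * (x * (x ^ 2 + b ^ 2)⁻¹) * kernelDeriv s 0 x b ∧
    kernelDeriv s 2 x b = (-(2 * s) * (x ^ 2 + b ^ 2)⁻¹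
      + 4 * s * (s + 1) * (x ^ 2 * (x ^ 2 + b ^ 2)⁻¹ ^ 2)) * kernelDeriv s 0 x b ∧
    kernelDeriv s 3 x b = (12 * s * (s + 1) * (x * (x ^ 2 + b ^ 2)⁻¹ ^ 2)
      - 8 * s * (s + 1) * (s + 2) * (x ^ 3 * (x ^ 2 + b ^ 2)⁻¹ ^ 3)) * kernelDeriv s 0 x b ∧
    kernelDeriv s 4 x b = (12 * s * (s + 1) * (x ^ 2 + b ^ 2)⁻¹ ^ 2
      - 48 * s * (s + 1) * (s + 2) * (x ^ 2 * (x ^ 2 + b ^ 2)⁻¹ ^ 3)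
      + 16 * s * (s + 1) * (s + 2) * (s + 3) * (x ^ 4 * (x ^ 2 + b ^ 2)⁻¹ ^ 4))
        * kernelDeriv s 0 x b := by
  have e : ∀ n : ℕ, (x ^ 2 + b ^ 2) ^ (-s - n) = (x ^ 2 + b ^ 2) ^ (-s) * (x ^ 2 + b ^ 2)⁻¹ ^ n := by
    intro n
    rw [Real.rpow_sub h, Real.rpow_natCast, inv_pow, div_eq_mul_inv]
  have e1 := e 1
  have e2 := e 2
  have e3 := e 3
  have e4 := e 4
  push_cast at e1 e2 e3 e4
  simp only [kernelDeriv, e1, e2, e3, e4]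
  refine ⟨?_, ?_, ?_, ?_⟩ <;> ring

end Quotients

section Quotients

/-- Used with `q = 1 / x`, to separate the homogeneous factor from a function of the direction of w.
As the interval contains `0`, a smaller `q ^ j` only helps. -/
theorem pow_mul_mem_Icc {q γ F c C : ℝ} (hq : 0 ≤ q) (hqγ : q ≤ 1 / γ) (j : ℕ)
    (hc : 0 ≤ c) (hC : 0 ≤ C) (h : F ∈ Icc (-c) C) :
    q ^ j * F ∈ Icc (-(c / γ ^ j)) (C / γ ^ j) := by
  have h1 : q ^ j ≤ 1 / γ ^ j := by
    rw [← one_div_pow]; exact pow_le_pow_left₀ hq hqγ j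
  have h0 : 0 ≤ q ^ j := pow_nonneg hq j
  have h2 : q ^ j * c ≤ c / γ ^ j := by
    rw [div_eq_mul_one_div, mul_comm]; gcongr
  have h3 : q ^ j * C ≤ C / γ ^ j := by
    rw [div_eq_mul_one_div, mul_comm]; gcongr
  constructor
  · nlinarith [mul_le_mul_of_nonneg_left h.1 h0]
  · nlinarith [mul_le_mul_of_nonneg_left h.2 h0]

variable {s p : ℝ}

/-- The minimum is at `p = 1 / (4 * (s + 1))`; the difference of the two sides is a multiple of the
corresponding square. -/
theorem quadratic_bound (hs : 0 < s) :
    -(s / (4 * (s + 1))) ≤ 2 * s * (p * (2 * (s + 1) * p - 1)) := by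
  rw [← neg_div, div_le_iff₀ (by positivity)]
  nlinarith [mul_nonneg hs.le (sq_nonneg (4 * (s + 1) * p - 1))]

theorem quadratic_bound' (hs : 0 < s) (hp : 0 ≤ p) (hp1 : p ≤ 1) :
    2 * s * (p * (2 * (s + 1) * p - 1)) ≤ 2 * s * (2 * s + 1) := by
  have : p * (2 * (s + 1) * p - 1) ≤ 1 * (2 * s + 1) := by
    have h1 : 2 * (s + 1) * p - 1 ≤ 2 * s + 1 := by nlinarith
    nlinarith
  nlinarith

/-- With u = (s + 2)p the claim is u²(3 - 2u) ≤ 1, and 1 - 3u² + 2u³ = (u - 1)²(2u + 1). -/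
theorem cubic_upper (hs : 0 < s) (hp : 0 ≤ p) :
    p ^ 2 * (3 - 2 * (s + 2) * p) ≤ 1 / (s + 2) ^ 2 := by
  rw [le_div_iff₀ (by positivity)]
  have h : 0 ≤ ((s + 2) * p - 1) ^ 2 * (2 * ((s + 2) * p) + 1) := by positivity
  nlinarith

theorem cubic_lower (hs : 0 < s) (hp : 0 ≤ p) (hp1 : p ≤ 1) :
    -(2 * s + 1) ≤ p ^ 2 * (3 - 2 * (s + 2) * p) := by
  have h1 : -(2 * s + 1) ≤ 3 - 2 * (s + 2) * p := by nlinarith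
  have h2 : p ^ 2 ≤ 1 := pow_le_one₀ hp hp1
  have h3 := mul_le_mul_of_nonneg_left h1 (sq_nonneg p)
  nlinarith

/-- Here `σ` is the share of the differentiated variable in x² + y²: it is `p` for x-derivatives and
`1 - p` for y-derivatives. The quadratic in `σ` is convex with minimum at 3/(2(s + 3)), and its
value at `σ = 1` is (2s + 1)(2s + 3). -/
theorem quartic_mem_Icc (hs : 0 < s) (hp : 0 ≤ p) (hp1 : p ≤ 1) {σ : ℝ} (hσ : 0 ≤ σ)
    (hσ1 : σ ≤ 1) :
    2 * s * (2 * s + 2) * (p ^ 2 * (3 - 12 * (s + 2) * σ + 4 * (s + 2) * (s + 3) * σ ^ 2)) ∈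
      Icc (-(2 * s * (2 * s + 2) * (3 * s + 3)))
        (2 * s * (2 * s + 1) * (2 * s + 2) * (2 * s + 3)) := by
  set Q := 3 - 12 * (s + 2) * σ + 4 * (s + 2) * (s + 3) * σ ^ 2 with hQ
  have hp2 : p ^ 2 ≤ 1 := pow_le_one₀ hp hp1
  have hp0 : 0 ≤ p ^ 2 := sq_nonneg p
  have hlow : -(3 * s + 3) ≤ Q := by
    have h1 : 0 ≤ (s + 2) * (2 * (s + 3) * σ - 3) ^ 2 := by positivity
    have h2 : 0 ≤ (s + 3) * (Q + (3 * s + 3)) := by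
      rw [hQ]; nlinarith [sq_nonneg s]
    have := nonneg_of_mul_nonneg_right h2 (by linarith : 0 < s + 3)
    linarith
  have hup : Q ≤ (2 * s + 1) * (2 * s + 3) := by
    have h1 : 0 ≤ (s + 2) * (s + 3) * (σ * (1 - σ)) := by
      have : 0 ≤ 1 - σ := by linarith
      positivity
    have h2 : 0 ≤ s * (1 - σ) := mul_nonneg hs.le (by linarith)
    have h3 : 0 ≤ s ^ 2 * (1 - σ) := mul_nonneg (sq_nonneg s) (by linarith)
    rw [hQ]; nlinarith
  have hcoef : 0 ≤ 2 * s * (2 * s + 2) := by positivity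
  have hl : -(3 * s + 3) ≤ p ^ 2 * Q := by nlinarith
  have hu : p ^ 2 * Q ≤ (2 * s + 1) * (2 * s + 3) := by
    have : 0 ≤ (2 * s + 1) * (2 * s + 3) := by positivity
    nlinarith
  constructor
  · have := mul_le_mul_of_nonneg_left hl hcoef; linarith
  · have := mul_le_mul_of_nonneg_left hu hcoef; linarith

/-- The maximum is at `p = 5 / 6`. Dividing the difference by the double root `(5 - 6 * p) ^ 2`
leaves a polynomial with positive coefficients. -/
theorem pow_five_mul_one_sub_le (hp : 0 ≤ p) : p ^ 5 * (1 - p) ≤ 3125 / 46656 := by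
  have h : 0 ≤ (5 - 6 * p) ^ 2 *
      (625 + 1500 * p + 2700 * p ^ 2 + 4320 * p ^ 3 + 6480 * p ^ 4) := by positivity
  nlinarith

/-- Here `p = x² / (x² + y²)` and `τ = y / x`. -/
theorem mixed_cubic_abs_le (hs : 0 < s) (hp : 0 ≤ p) (hp1 : p ≤ 1) {τ : ℝ}
    (hτ : p * (1 + τ ^ 2) = 1) :
    |τ * p ^ 2 * (3 * p - (2 * s + 1) * (1 - p))| ≤
      max (25 * Real.sqrt 5 / 72) ((2 * s + 1) / 8) := by
  have hT : |τ| ^ 2 * p = 1 - p := by rw [sq_abs]; linarith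
  have ht : 0 ≤ |τ| := abs_nonneg τ
  have hh : |τ| * p ≤ 1 / 2 := by nlinarith [mul_nonneg hp (sq_nonneg (1 - |τ|))]
  -- The square of the left side is 9p⁵(1 - p), whose maximum 3125/5184 is the square of 25√5/72.
  have h1 : 3 * (|τ| * p ^ 3) ≤ 25 * Real.sqrt 5 / 72 := by
    refine (sq_le_sq₀ (by positivity) (by positivity)).1 ?_
    have e : (3 * (|τ| * p ^ 3)) ^ 2 = 9 * (p ^ 5 * (|τ| ^ 2 * p)) := by ring
    have e2 : (25 * Real.sqrt 5 / 72) ^ 2 = 3125 / 5184 := by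
      rw [div_pow, mul_pow, Real.sq_sqrt (by norm_num)]; norm_num
    rw [e, hT, e2]
    linarith [pow_five_mul_one_sub_le hp]
  have h2 : |τ| * p ^ 2 * (1 - p) ≤ 1 / 8 := by
    rw [← hT]
    have : (|τ| * p) ^ 3 ≤ (1 / 2) ^ 3 := pow_le_pow_left₀ (by positivity) hh 3
    nlinarith
  rw [abs_mul, abs_mul, abs_of_nonneg (sq_nonneg p)]
  have h3 : 0 ≤ |τ| * p ^ 2 := by positivity
  -- The two terms in the bracket have opposite signs, so only one of them counts; this gives a
  -- maximum instead of a sum.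
  rcases le_total 0 (3 * p - (2 * s + 1) * (1 - p)) with h | h
  · rw [abs_of_nonneg h]
    refine le_trans ?_ (le_max_left _ _)
    have : 0 ≤ (2 * s + 1) * (1 - p) := mul_nonneg (by linarith) (by linarith)
    nlinarith [mul_nonneg h3 this]
  · rw [abs_of_nonpos h]
    refine le_trans ?_ (le_max_right _ _)
    nlinarith [mul_nonneg h3 hp]

theorem kernelDeriv_left_mem_Icc (hs : 0 < s) {γ x : ℝ} (hγ : 0 < γ) (hx : γ ≤ x) (y : ℝ) :
    kernelDeriv s 1 x y / kernelDeriv s 0 x y ∈ Icc (-(2 * s / γ)) 0 ∧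
    kernelDeriv s 2 x y / kernelDeriv s 0 x y ∈
      Icc (-(s / (4 * γ ^ 2 * (s + 1)))) (2 * s * (2 * s + 1) / γ ^ 2) ∧
    kernelDeriv s 3 x y / kernelDeriv s 0 x y ∈
      Icc (-(2 * s * (2 * s + 1) * (2 * s + 2) / γ ^ 3))
        (2 * s * (2 * s + 2) / (γ ^ 3 * (s + 2) ^ 2)) ∧
    kernelDeriv s 4 x y / kernelDeriv s 0 x y ∈
      Icc (-(2 * s * (2 * s + 2) * (3 * s + 3) / γ ^ 4))
        (2 * s * (2 * s + 1) * (2 * s + 2) * (2 * s + 3) / γ ^ 4) := by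
  have hx0 : 0 < x := hγ.trans_le hx
  have hR : 0 < x ^ 2 + y ^ 2 := by positivity
  have hk : kernelDeriv s 0 x y ≠ 0 := (Real.rpow_pos_of_pos hR _).ne'
  obtain ⟨h1, h2, h3, h4⟩ := kernelDeriv_eq hR s
  rw [h1, h2, h3, h4]
  simp only [mul_div_cancel_right₀ _ hk]
  obtain ⟨p, hp⟩ : ∃ p, p = x ^ 2 * (x ^ 2 + y ^ 2)⁻¹ := ⟨_, rfl⟩
  have hp0 : 0 ≤ p := by rw [hp]; positivity
  have hp1 : p ≤ 1 := by
    rw [hp, ← div_eq_mul_inv, div_le_one hR]; nlinarith [sq_nonneg y]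
  have hρ : (x ^ 2 + y ^ 2)⁻¹ = p * (1 / x) ^ 2 := by
    rw [hp]; field_simp
  rw [hρ]
  have hq0 : 0 ≤ 1 / x := by positivity
  have hq1 : 1 / x ≤ 1 / γ := one_div_le_one_div_of_le hγ hx
  have key := fun (j : ℕ) (F c C : ℝ) => @pow_mul_mem_Icc (1 / x) γ F c C hq0 hq1 j
  refine ⟨?_, ?_, ?_, ?_⟩
  · convert key 1 (-(2 * s) * p) (2 * s) 0 (by positivity) le_rfl ⟨by nlinarith, by nlinarith⟩
      using 1
    · simp
    · field_simp
  · convert key 2 (2 * s * (p * (2 * (s + 1) * p - 1))) (s / (4 * (s + 1))) (2 * s * (2 * s + 1))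
      (by positivity) (by positivity) ⟨quadratic_bound hs, quadratic_bound' hs hp0 hp1⟩ using 1
    · congr 1; field_simp
    · field_simp; ring
  · have hc : 0 ≤ 2 * s * (2 * s + 2) := by positivity
    convert key 3 (2 * s * (2 * s + 2) * (p ^ 2 * (3 - 2 * (s + 2) * p)))
      (2 * s * (2 * s + 1) * (2 * s + 2)) (2 * s * (2 * s + 2) * (1 / (s + 2) ^ 2))
      (by positivity) (by positivity) ⟨?_, ?_⟩ using 1
    · congr 1; field_simp
    · field_simp; ring
    · linarith [mul_le_mul_of_nonneg_left (cubic_lower hs hp0 hp1) hc]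
    · exact mul_le_mul_of_nonneg_left (cubic_upper hs hp0) hc
  · convert key 4 _ _ _ (by positivity) (by positivity) (quartic_mem_Icc hs hp0 hp1 hp0 hp1) using 1
    field_simp; ring

/-- Now y = τx is the differentiated variable, while powers of `1 / x` are still extracted, since
only x is bounded below by `γ`. Then τ²p = 1 - p, and odd orders keep one factor `τ`. -/
theorem kernelDeriv_right_mem_Icc (hs : 0 < s) {γ x : ℝ} (hγ : 0 < γ) (hx : γ ≤ x) (y : ℝ) :
    kernelDeriv s 1 y x / kernelDeriv s 0 y x ∈ Icc (-(s / γ)) (s / γ) ∧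
    kernelDeriv s 2 y x / kernelDeriv s 0 y x ∈
      Icc (-(2 * s / γ ^ 2)) (2 * s * (2 * s + 1) / (4 * γ ^ 2)) ∧
    kernelDeriv s 3 y x / kernelDeriv s 0 y x ∈
      Icc (-(2 * s * (2 * s + 2) / γ ^ 3 * max (25 * Real.sqrt 5 / 72) ((2 * s + 1) / 8)))
        (2 * s * (2 * s + 2) / γ ^ 3 * max (25 * Real.sqrt 5 / 72) ((2 * s + 1) / 8)) ∧
    kernelDeriv s 4 y x / kernelDeriv s 0 y x ∈
      Icc (-(2 * s * (2 * s + 2) * (3 * s + 3) / γ ^ 4))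
        (2 * s * (2 * s + 1) * (2 * s + 2) * (2 * s + 3) / γ ^ 4) := by
  have hx0 : 0 < x := hγ.trans_le hx
  have hR : 0 < y ^ 2 + x ^ 2 := by positivity
  have hk : kernelDeriv s 0 y x ≠ 0 := (Real.rpow_pos_of_pos hR _).ne'
  obtain ⟨h1, h2, h3, h4⟩ := kernelDeriv_eq hR s
  rw [h1, h2, h3, h4]
  simp only [mul_div_cancel_right₀ _ hk]
  obtain ⟨p, hp⟩ : ∃ p, p = x ^ 2 * (y ^ 2 + x ^ 2)⁻¹ := ⟨_, rfl⟩
  obtain ⟨τ, hτ⟩ : ∃ τ, τ = y / x := ⟨_, rfl⟩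
  have hp0 : 0 ≤ p := by rw [hp]; positivity
  have hp1 : p ≤ 1 := by
    rw [hp, ← div_eq_mul_inv, div_le_one hR]; nlinarith [sq_nonneg y]
  have hρ : (y ^ 2 + x ^ 2)⁻¹ = p * (1 / x) ^ 2 := by
    rw [hp]; field_simp
  have hy : y = τ * x := by rw [hτ]; field_simp
  have hpτ : p * (1 + τ ^ 2) = 1 := by
    rw [hp, hτ]; field_simp; ring
  have hτp : τ ^ 2 * p = 1 - p := by linarith
  rw [hρ]
  clear h1 h2 h3 h4 hk hρ hR hp
  subst hy
  have hq0 : 0 ≤ 1 / x := by positivity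
  have hq1 : 1 / x ≤ 1 / γ := one_div_le_one_div_of_le hγ hx
  have key := fun (j : ℕ) (F c C : ℝ) => @pow_mul_mem_Icc (1 / x) γ F c C hq0 hq1 j
  refine ⟨?_, ?_, ?_, ?_⟩
  · convert key 1 (-(2 * s) * (τ * p)) s s hs.le hs.le ⟨?_, ?_⟩ using 1
    · simp
    · field_simp
    · nlinarith [mul_nonneg hs.le (mul_nonneg hp0 (sq_nonneg (1 - τ)))]
    · nlinarith [mul_nonneg hs.le (mul_nonneg hp0 (sq_nonneg (1 + τ)))]
  · convert key 2 (2 * s * (p * (2 * s + 1 - (2 * s + 2) * p))) (2 * s) (2 * s * (2 * s + 1) / 4)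
      (by positivity) (by positivity) ⟨?_, ?_⟩ using 1
    · congr 1; field_simp
    · have e : 2 * s + 1 - (2 * s + 2) * p = -1 + (2 * s + 2) * (τ ^ 2 * p) := by rw [hτp]; ring
      rw [e]; field_simp; ring
    · have h1 : -1 ≤ 2 * s + 1 - (2 * s + 2) * p := by nlinarith
      have : -1 ≤ p * (2 * s + 1 - (2 * s + 2) * p) := by
        linarith [mul_le_mul_of_nonneg_left h1 hp0]
      nlinarith
    · have : p * (2 * s + 1 - (2 * s + 2) * p) ≤ (2 * s + 1) / 4 := by
        nlinarith [mul_nonneg (by linarith : 0 ≤ 2 * s + 1) (sq_nonneg (2 * p - 1)),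
          mul_nonneg hp0 hp0]
      nlinarith
  · have hm := mixed_cubic_abs_le hs hp0 hp1 hpτ
    rw [abs_le] at hm
    have hc : 0 ≤ 2 * s * (2 * s + 2) := by positivity
    have hmax : 0 ≤ max (25 * Real.sqrt 5 / 72) ((2 * s + 1) / 8) :=
      le_max_of_le_right (by positivity)
    set mm := max (25 * Real.sqrt 5 / 72) ((2 * s + 1) / 8) with hmm
    convert key 3 (2 * s * (2 * s + 2) * (τ * p ^ 2 * (3 * p - (2 * s + 1) * (1 - p))))
      (2 * s * (2 * s + 2) * mm) (2 * s * (2 * s + 2) * mm)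
      (mul_nonneg hc hmax) (mul_nonneg hc hmax) ⟨?_, ?_⟩ using 1
    · congr 1 <;> ring
    · have e : 3 * p - (2 * s + 1) * (1 - p) = 3 - 2 * (s + 2) * (τ ^ 2 * p) := by rw [hτp]; ring
      rw [e]; field_simp; ring
    · linarith [mul_le_mul_of_nonneg_left hm.1 hc]
    · exact mul_le_mul_of_nonneg_left hm.2 hc
  · convert key 4 _ _ _ (by positivity) (by positivity)
      (quartic_mem_Icc hs hp0 hp1 (σ := 1 - p) (by linarith) (by linarith)) using 1
    rw [← hτp]
    field_simp; ring

end Quotients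

/-! ### Superpositions of translated kernels. -/

section Superposition

open MeasureTheory

variable {K : Set ℂ}

/-- The superposition `z ↦ ∫ g(z + δ) dμ(δ)` of translates of `g`. -/
noncomputable def translateIntegral (μ : Measure K) (g : ℂ → ℝ) (z : ℂ) : ℝ :=
  ∫ δ : K, g (z + δ) ∂μ

/-- The singularities lie in Re z ≤ -1, so superpositions are regular on a neighbourhood of Re z ≥
0. -/
theorem add_mem_rightHalfPlane (hK : ∀ δ ∈ K, 1 ≤ δ.re) {z : ℂ} (hz : z ∈ rightHalfPlane (-1))
    (δ : K) : z + δ ∈ rightHalfPlane 0 := by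
  have h1 := hK δ δ.2
  have h2 := mem_rightHalfPlane.1 hz
  rw [mem_rightHalfPlane, Complex.add_re]
  linarith

theorem continuous_translate {E : Type*} [TopologicalSpace E] (hK : ∀ δ ∈ K, 1 ≤ δ.re)
    {g : ℂ → E} (hg : ContinuousOn g (rightHalfPlane 0)) {z : ℂ} (hz : z ∈ rightHalfPlane (-1)) :
    Continuous fun δ : K => g (z + δ) :=
  hg.comp_continuous (by fun_prop) (add_mem_rightHalfPlane hK hz)

variable [CompactSpace K] {μ : Measure K} [IsFiniteMeasure μ]

theorem integrable_translate {E : Type*} [NormedAddCommGroup E] (hK : ∀ δ ∈ K, 1 ≤ δ.re)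
    {g : ℂ → E} (hg : ContinuousOn g (rightHalfPlane 0)) {z : ℂ} (hz : z ∈ rightHalfPlane (-1)) :
    Integrable (fun δ : K => g (z + δ)) μ :=
  (continuous_translate hK hg hz).integrable_of_hasCompactSupport (HasCompactSupport.of_compactSpace _)

theorem hasFDerivAt_translateIntegral (hK : ∀ δ ∈ K, 1 ≤ δ.re) {g : ℂ → ℝ}
    (hg : ContDiffOn ℝ 1 g (rightHalfPlane 0)) {z : ℂ} (hz : z ∈ rightHalfPlane (-1)) :
    HasFDerivAt (translateIntegral μ g) (∫ δ : K, fderiv ℝ g (z + δ) ∂μ) z := by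
  have hg' : ContinuousOn (fderiv ℝ g) (rightHalfPlane 0) :=
    hg.continuousOn_fderiv_of_isOpen (rightHalfPlane 0).isOpen le_rfl
  obtain ⟨ε, hε, hball⟩ := Metric.nhds_basis_closedBall.mem_iff.1
    ((rightHalfPlane (-1)).isOpen.mem_nhds hz)
  -- Compactness of `K` and of a small ball gives a constant dominating function.
  have hcpt : IsCompact (Metric.closedBall z ε ×ˢ (univ : Set K)) :=
    (isCompact_closedBall z ε).prod isCompact_univ
  have hcont : ContinuousOn (fun q : ℂ × K => fderiv ℝ g (q.1 + q.2))
      (Metric.closedBall z ε ×ˢ (univ : Set K)) :=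
    hg'.comp (by fun_prop) fun q hq => add_mem_rightHalfPlane hK (hball hq.1) q.2
  obtain ⟨C, hC⟩ := hcpt.exists_bound_of_continuousOn hcont
  refine hasFDerivAt_integral_of_dominated_of_fderiv_le (bound := fun _ => C)
    (F := fun z (δ : K) => g (z + δ)) (F' := fun z (δ : K) => fderiv ℝ g (z + δ))
    (Metric.closedBall_mem_nhds z hε) ?_ (integrable_translate hK hg.continuousOn hz) ?_ ?_
    (integrable_const C) ?_
  · filter_upwards [(rightHalfPlane (-1)).isOpen.mem_nhds hz] with w hw
    exact (integrable_translate hK hg.continuousOn hw).aestronglyMeasurable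
  · exact (integrable_translate hK hg' hz).aestronglyMeasurable
  · exact Filter.Eventually.of_forall fun δ w hw => hC (w, δ) ⟨hw, mem_univ _⟩
  · refine Filter.Eventually.of_forall fun δ w hw => ?_
    have h1 : DifferentiableAt ℝ g (w + δ) := (hg.differentiableOn (by norm_num)).differentiableAt
      ((rightHalfPlane 0).isOpen.mem_nhds (add_mem_rightHalfPlane hK (hball hw) δ))
    exact (hasFDerivAt_comp_add_right (δ : ℂ)).2 h1.hasFDerivAt

theorem fderiv_translateIntegral (hK : ∀ δ ∈ K, 1 ≤ δ.re) {g : ℂ → ℝ}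
    (hg : ContDiffOn ℝ 1 g (rightHalfPlane 0)) {z : ℂ} (hz : z ∈ rightHalfPlane (-1)) (e : ℂ) :
    fderiv ℝ (translateIntegral μ g) z e = translateIntegral μ (fun w => fderiv ℝ g w e) z := by
  have hg' : ContinuousOn (fderiv ℝ g) (rightHalfPlane 0) :=
    hg.continuousOn_fderiv_of_isOpen (rightHalfPlane 0).isOpen le_rfl
  rw [(hasFDerivAt_translateIntegral hK hg hz).fderiv,
    ContinuousLinearMap.integral_apply (integrable_translate hK hg' hz)]
  rfl

/-- One order is given away so that the base case gets continuity from differentiability; for the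
smooth kernel nothing is lost. -/
theorem contDiffOn_translateIntegral (hK : ∀ δ ∈ K, 1 ≤ δ.re) {g : ℂ → ℝ} {n : ℕ}
    (hg : ContDiffOn ℝ (n + 1 : ℕ) g (rightHalfPlane 0)) :
    ContDiffOn ℝ n (translateIntegral μ g) (rightHalfPlane (-1)) := by
  have h1 : ∀ {n : ℕ} {g : ℂ → ℝ}, ContDiffOn ℝ (n + 1 : ℕ) g (rightHalfPlane 0) →
      ContDiffOn ℝ 1 g (rightHalfPlane 0) := fun h =>
    h.of_le (by exact_mod_cast Nat.le_add_left 1 _)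
  have hd : ∀ {g : ℂ → ℝ}, ContDiffOn ℝ 1 g (rightHalfPlane 0) →
      DifferentiableOn ℝ (translateIntegral μ g) (rightHalfPlane (-1)) := fun hg z hz =>
    (hasFDerivAt_translateIntegral hK hg hz).differentiableAt.differentiableWithinAt
  induction n generalizing g with
  | zero => exact contDiffOn_zero.2 (hd (h1 hg)).continuousOn
  | succ n ih =>
    refine contDiffOn_succ_of_partial (hd (h1 hg)) ?_ ?_
    · exact (ih (contDiffOn_partialX hg)).congr fun z hz => fderiv_translateIntegral hK (h1 hg) hz 1
    · exact (ih (contDiffOn_partialY hg)).congr fun z hz =>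
        fderiv_translateIntegral hK (h1 hg) hz Complex.I

theorem partialD_translateIntegral (hK : ∀ δ ∈ K, 1 ≤ δ.re) {g : ℂ → ℝ}
    (hg : ∀ n : ℕ, ContDiffOn ℝ n g (rightHalfPlane 0)) (a b : ℕ) :
    EqOn (partialD a b (translateIntegral μ g)) (translateIntegral μ (partialD a b g))
      (rightHalfPlane (-1)) := by
  have hb : EqOn (partialD 0 b (translateIntegral μ g)) (translateIntegral μ (partialD 0 b g))
      (rightHalfPlane (-1)) := by
    induction b with
    | zero => exact fun _ _ => rfl
    | succ b ih =>
      have e : ∀ f : ℂ → ℝ, partialD 0 (b + 1) f = partialY (partialD 0 b f) := fun f => by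
        simp only [partialD, Function.iterate_succ_apply', Function.iterate_zero, id]
      rw [e, e]
      exact (eqOn_partialY ih).trans fun z hz =>
        fderiv_translateIntegral hK (contDiffOn_partialD (n := 1) (hg _)) hz Complex.I
  induction a with
  | zero => exact hb
  | succ a ih =>
    rw [partialD_succ_left, partialD_succ_left]
    exact (eqOn_partialX ih).trans fun z hz =>
      fderiv_translateIntegral hK (contDiffOn_partialD (n := 1) (hg _)) hz 1

theorem translateIntegral_pos (hK : ∀ δ ∈ K, 1 ≤ δ.re) (hμ : μ ≠ 0) {g : ℂ → ℝ}
    (hg : ContinuousOn g (rightHalfPlane 0)) (hpos : ∀ w ∈ rightHalfPlane 0, 0 < g w) {z : ℂ}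
    (hz : z ∈ rightHalfPlane (-1)) : 0 < translateIntegral μ g z := by
  have hp : ∀ δ : K, 0 < g (z + δ) := fun δ => hpos _ (add_mem_rightHalfPlane hK hz δ)
  rw [translateIntegral, integral_pos_iff_support_of_nonneg (fun δ => (hp δ).le)
    (integrable_translate hK hg hz)]
  have : Function.support (fun δ : K => g (z + δ)) = univ :=
    eq_univ_of_forall fun δ => (hp δ).ne'
  rw [this]
  exact (Measure.measure_univ_ne_zero.2 hμ).bot_lt

/-- Pointwise bounds for a quotient pass to superpositions. -/
theorem translateIntegral_div_mem_Icc {γ : ℝ} (hγ : 1 ≤ γ) (hK : ∀ δ ∈ K, γ ≤ δ.re) (hμ : μ ≠ 0)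
    {g h : ℂ → ℝ} (hg : ContinuousOn g (rightHalfPlane 0)) (hh : ContinuousOn h (rightHalfPlane 0))
    (hpos : ∀ w ∈ rightHalfPlane 0, 0 < g w) {lo hi : ℝ}
    (hb : ∀ w : ℂ, γ ≤ w.re → h w / g w ∈ Icc lo hi) {z : ℂ} (hz : 0 ≤ z.re) :
    translateIntegral μ h z / translateIntegral μ g z ∈ Icc lo hi := by
  have hK1 : ∀ δ ∈ K, 1 ≤ δ.re := fun δ hδ => hγ.trans (hK δ hδ)
  have hz1 : z ∈ rightHalfPlane (-1) := mem_rightHalfPlane.2 (by linarith)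
  have hv := translateIntegral_pos hK1 hμ hg hpos hz1
  have hgi := integrable_translate (μ := μ) hK1 hg hz1
  have hhi := integrable_translate (μ := μ) hK1 hh hz1
  have hw : ∀ δ : K, lo * g (z + δ) ≤ h (z + δ) ∧ h (z + δ) ≤ hi * g (z + δ) := by
    intro δ
    have h0 := hpos _ (add_mem_rightHalfPlane hK1 hz1 δ)
    have h1 := hb (z + δ) (by have := hK δ δ.2; rw [Complex.add_re]; linarith)
    rwa [mem_Icc, le_div_iff₀ h0, div_le_iff₀ h0] at h1
  rw [mem_Icc, le_div_iff₀ hv, div_le_iff₀ hv]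
  unfold translateIntegral
  rw [← integral_const_mul, ← integral_const_mul]
  exact ⟨integral_mono (hgi.const_mul lo) hhi fun δ => (hw δ).1,
    integral_mono hhi (hgi.const_mul hi) fun δ => (hw δ).2⟩

end Superposition

/-! ### Möbius maps: image disc, strict contraction, intertwining. -/

section Mobius

theorem normKernel_mul (s : ℝ) (a b : ℂ) :
    normKernel s (a * b) = normKernel s a * normKernel s b := by
  have e : ∀ w : ℂ, w.re ^ 2 + w.im ^ 2 = Complex.normSq w := fun w => by
    rw [Complex.normSq_apply]; ring
  rw [normKernel, normKernel, normKernel, e, e, e, map_mul,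
    Real.mul_rpow (Complex.normSq_nonneg _) (Complex.normSq_nonneg _)]

theorem ne_zero_of_re_pos {w : ℂ} (hw : 0 < w.re) : w ≠ 0 := by
  rintro rfl; simp at hw

theorem inv_re_pos {w : ℂ} (hw : 0 < w.re) : 0 < (1 / w).re := by
  rw [one_div, Complex.inv_re]
  exact div_pos hw (Complex.normSq_pos.2 (ne_zero_of_re_pos hw))

theorem norm_deriv_mobiusTheta_rpow (s : ℝ) {β z : ℂ} (h : z + β ≠ 0) :
    ‖deriv (mobiusTheta β) z‖ ^ s = normKernel s (z + β) := by
  have hd : HasDerivAt (mobiusTheta β) (-1 / (z + β) ^ 2) z := by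
    have := ((hasDerivAt_id z).add_const β).inv h
    convert! this using 1
    funext x
    simp [mobiusTheta]
  have hN := Complex.normSq_nonneg (z + β)
  rw [hd.deriv, norm_div, norm_neg, norm_one, norm_pow, normKernel, Complex.sq_norm,
    one_div, Real.inv_rpow hN, ← Real.rpow_neg hN, Complex.normSq_apply, ← sq, ← sq]

/-- With w = z + β, the point 1/w lies in the disc exactly when |2γ - w| < |w|, that is, when w is
closer to 2γ than to 0. -/
theorem mobiusTheta_mem_discG {γ : ℝ} (hγ : 0 < γ) {β z : ℂ} (h : γ < (z + β).re) :
    mobiusTheta β z ∈ discG γ := by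
  have hw : z + β ≠ 0 := ne_zero_of_re_pos (hγ.trans h)
  have hγ' : (γ : ℂ) ≠ 0 := by exact_mod_cast hγ.ne'
  change ‖1 / (z + β) - 1 / (2 * (γ : ℂ))‖ < 1 / (2 * γ)
  generalize z + β = w at h hw
  have e : 1 / w - 1 / (2 * (γ : ℂ)) = (2 * γ - w) / (2 * γ * w) := by field_simp
  have hn : ‖(2 * γ : ℂ)‖ = 2 * γ := by
    rw [norm_mul, Complex.norm_real, Real.norm_of_nonneg hγ.le]; simp
  have hlt : ‖2 * (γ : ℂ) - w‖ < ‖w‖ := by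
    rw [← sq_lt_sq₀ (norm_nonneg _) (norm_nonneg _), Complex.sq_norm, Complex.sq_norm,
      Complex.normSq_apply, Complex.normSq_apply]
    simp
    nlinarith
  rw [e, norm_div, norm_mul, hn, div_lt_div_iff₀ (by positivity) (by positivity)]
  nlinarith

/-- The distance is divided by |a + β||b + β| ≥ 1, and equality would force a + β = b + β = 1. No
uniform contraction factor is claimed: θ_1 has derivative of modulus 1 at 0. -/
theorem norm_mobiusTheta_sub_lt {β a b : ℂ} (hβ : 1 ≤ β.re) (ha : 0 ≤ a.re) (hb : 0 ≤ b.re)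
    (hab : a ≠ b) : ‖mobiusTheta β a - mobiusTheta β b‖ < ‖a - b‖ := by
  have hare : 1 ≤ (a + β).re := by rw [Complex.add_re]; linarith
  have hbre : 1 ≤ (b + β).re := by rw [Complex.add_re]; linarith
  have ha0 : a + β ≠ 0 := ne_zero_of_re_pos (by linarith)
  have hb0 : b + β ≠ 0 := ne_zero_of_re_pos (by linarith)
  have e : mobiusTheta β a - mobiusTheta β b = (b - a) / ((a + β) * (b + β)) := by
    simp only [mobiusTheta]; field_simp; ring
  have h1 : ∀ w : ℂ, 1 ≤ w.re → 1 ≤ ‖w‖ := fun w hw => hw.trans (Complex.re_le_norm w)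
  have h2 : ∀ w : ℂ, 1 ≤ w.re → ‖w‖ ≤ 1 → w = 1 := by
    intro w hw hn
    have hsq : ‖w‖ ^ 2 ≤ 1 := pow_le_one₀ (norm_nonneg _) hn
    rw [Complex.sq_norm, Complex.normSq_apply] at hsq
    have him : w.im * w.im ≤ 0 := by nlinarith
    apply Complex.ext
    · exact le_antisymm ((Complex.re_le_norm w).trans hn) hw
    · exact mul_self_eq_zero.1 (le_antisymm him (mul_self_nonneg _))
  have hprod : 1 < ‖a + β‖ * ‖b + β‖ := by
    by_contra! hle
    have hA := h1 _ hare
    have hB := h1 _ hbre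
    have ea := h2 _ hare (by nlinarith)
    have eb := h2 _ hbre (by nlinarith)
    exact hab (add_right_cancel (ea.trans eb.symm))
  rw [e, norm_div, norm_mul, norm_sub_rev]
  exact div_lt_self (norm_pos_iff.2 (sub_ne_zero.2 hab)) hprod

theorem contDiffOn_mobiusTheta {β : ℂ} (hβ : 1 ≤ β.re) (n : ℕ) :
    ContDiffOn ℝ n (mobiusTheta β) (rightHalfPlane (-1)) := by
  have e : mobiusTheta β = fun z => (z + β)⁻¹ := by
    funext z
    rw [mobiusTheta, one_div]
  rw [e]
  refine ContDiffOn.inv (by fun_prop) fun z hz => ne_zero_of_re_pos ?_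
  have := mem_rightHalfPlane.1 hz
  rw [Complex.add_re]; linarith

theorem contDiffOn_normKernel_add (s : ℝ) {β : ℂ} (hβ : 1 ≤ β.re) (n : ℕ) :
    ContDiffOn ℝ n (fun z => normKernel s (z + β)) (rightHalfPlane (-1)) := by
  refine (contDiffOn_normKernel s n).comp (by fun_prop) fun z hz => ?_
  have := mem_rightHalfPlane.1 hz
  change 0 < (z + β).re
  rw [Complex.add_re]; linarith

/-- The change of variables which intertwines the action on points with the action on poles. -/
theorem normKernel_intertwine (s : ℝ) {β z δ : ℂ} (hβ : z + β ≠ 0) (hδ : δ ≠ 0) :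
    normKernel s (z + β) * normKernel s (mobiusTheta β z + δ)
      = normKernel s δ * normKernel s (z + (β + 1 / δ)) := by
  rw [← normKernel_mul, ← normKernel_mul, mobiusTheta]
  -- Both arguments equal 1 + δ(z + β).
  congr 1
  field_simp
  ring

end Mobius

/-! ### The eigenfunction from an eigenmeasure on the poles. -/

section Eigenfunction

open MeasureTheory

/-- A positive eigenfunction of the transfer operator as a superposition of translated kernels. -/
theorem exists_translateIntegral_eigenfunction {γ : ℝ} (s : ℝ) (hγ : 1 ≤ γ) {B : Finset ℂ}
    (hB : B.Nonempty) (hBγ : ∀ β ∈ B, γ ≤ β.re) :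
    ∃ (K : Set ℂ) (_ : CompactSpace K) (μ : Measure K) (_ : IsFiniteMeasure μ) (r : ℝ),
      (∀ δ ∈ K, γ ≤ δ.re) ∧ μ ≠ 0 ∧ 0 < r ∧ ∀ z : ℂ, 0 ≤ z.re →
        transferSum s B (translateIntegral μ (normKernel s)) z
          = r * translateIntegral μ (normKernel s) z := by
  have hγ0 : 0 < γ := by linarith
  obtain ⟨M, hM⟩ : ∃ M : ℝ, ∀ β ∈ B, ‖β‖ + 1 ≤ M :=
    ⟨∑ β ∈ B, ‖β‖ + 1, fun β hβ => by
      linarith [Finset.single_le_sum (f := fun β : ℂ => ‖β‖) (fun i _ => norm_nonneg i) hβ]⟩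
  -- The radius makes `K` invariant under δ ↦ β + 1/δ: on `K` one has |δ| ≥ 1, hence |β + 1/δ| ≤ |β|
  -- + 1 ≤ M, while Re(1/δ) > 0 preserves the half-plane.
  let K : Set ℂ := {δ | γ ≤ δ.re} ∩ Metric.closedBall 0 M
  have hKcpt : IsCompact K := (isCompact_closedBall 0 M).inter_left
    (isClosed_le continuous_const Complex.continuous_re)
  have hKγ : ∀ δ ∈ K, γ ≤ δ.re := fun δ hδ => hδ.1
  have hK1 : ∀ δ ∈ K, 1 ≤ δ.re := fun δ hδ => hγ.trans (hKγ δ hδ)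
  have hKne : ∀ δ ∈ K, δ ≠ 0 := fun δ hδ => ne_zero_of_re_pos (by linarith [hK1 δ hδ])
  have : CompactSpace K := isCompact_iff_compactSpace.1 hKcpt
  have : Nonempty K := by
    obtain ⟨β, hβ⟩ := hB
    refine ⟨⟨β, hBγ β hβ, ?_⟩⟩
    rw [mem_closedBall_zero_iff]
    linarith [hM β hβ]
  have hmap : ∀ β ∈ B, ∀ δ : K, β + 1 / (δ : ℂ) ∈ K := by
    intro β hβ δ
    have hδ := hK1 δ δ.2
    refine ⟨?_, ?_⟩
    · have := inv_re_pos (w := δ) (by linarith)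
      have := hBγ β hβ
      change γ ≤ (β + 1 / (δ : ℂ)).re
      rw [Complex.add_re]; linarith
    · rw [mem_closedBall_zero_iff]
      have h1 : 1 ≤ ‖(δ : ℂ)‖ := hδ.trans (Complex.re_le_norm _)
      have h2 : ‖1 / (δ : ℂ)‖ ≤ 1 := by
        rw [norm_div, norm_one, div_le_one (by linarith)]; exact h1
      linarith [norm_add_le β (1 / (δ : ℂ)), hM β hβ]
  have hkc : ContinuousOn (normKernel s) (rightHalfPlane 0) :=
    (contDiffOn_normKernel s 0).continuousOn
  let σ : B → C(K, K) := fun β => ⟨fun δ => ⟨β + 1 / (δ : ℂ), hmap β β.2 δ⟩, by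
    refine Continuous.subtype_mk ?_ _
    exact continuous_const.add (continuous_const.div continuous_subtype_val fun δ => hKne δ δ.2)⟩
  have hKpos : ∀ δ : K, (δ : ℂ) ∈ rightHalfPlane 0 := fun δ => by
    rw [mem_rightHalfPlane]; linarith [hK1 δ δ.2]
  let κ : C(K, ℝ) := ⟨fun δ => normKernel s δ, hkc.comp_continuous continuous_subtype_val hKpos⟩
  have hκ : ∀ δ : K, 0 < κ δ := fun δ => normKernel_pos s (hKpos δ)
  -- The dual form of the transfer operator, acting on the pole δ with weight |δ|^(-2s).
  let T : C(K, ℝ) →ₗ[ℝ] C(K, ℝ) :=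
    { toFun := fun g => κ * ∑ β, g.comp (σ β)
      map_add' := fun f g => by
        ext δ; simp [Finset.sum_add_distrib, mul_add]
      map_smul' := fun c g => by
        ext δ; simp [← Finset.mul_sum, mul_left_comm] }
  have hT : ∀ (g : C(K, ℝ)) (δ : K), T g δ = κ δ * ∑ β, g (σ β δ) := fun g δ => by
    simp [T]
  have : Nonempty B := hB.to_subtype
  obtain ⟨μ, r, hμf, hμ, hr, heig⟩ := exists_eigenmeasure T
    (fun g hg δ => by
      rw [hT]; exact mul_nonneg (hκ δ).le (Finset.sum_nonneg fun β _ => hg _))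
    (fun δ => by
      rw [hT]
      exact mul_pos (hκ δ) (Finset.sum_pos (fun β _ => by simp) Finset.univ_nonempty))
  refine ⟨K, inferInstance, μ, hμf, r, hKγ, hμ, hr, fun z hz => ?_⟩
  have hz1 : z ∈ rightHalfPlane (-1) := mem_rightHalfPlane.2 (by linarith)
  have hzβ : ∀ β ∈ B, 0 < (z + β).re := fun β hβ => by
    rw [Complex.add_re]; linarith [hBγ β hβ]
  let kz : C(K, ℝ) := ⟨fun δ => normKernel s (z + δ), continuous_translate hK1 hkc hz1⟩
  have hθ : ∀ β ∈ B, mobiusTheta β z ∈ rightHalfPlane (-1) := fun β hβ => by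
    have := inv_re_pos (hzβ β hβ)
    rw [mem_rightHalfPlane]
    change -1 < (1 / (z + β)).re
    linarith
  calc transferSum s B (translateIntegral μ (normKernel s)) z
      = ∑ β ∈ B, ∫ δ : K, normKernel s (z + β) * normKernel s (mobiusTheta β z + δ) ∂μ := by
        refine Finset.sum_congr rfl fun β hβ => ?_
        rw [norm_deriv_mobiusTheta_rpow s (ne_zero_of_re_pos (hzβ β hβ)), translateIntegral,
          integral_const_mul]
    _ = ∫ δ : K, ∑ β ∈ B, normKernel s (z + β) * normKernel s (mobiusTheta β z + δ) ∂μ :=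
        (integral_finsetSum _ fun β hβ =>
          (integrable_translate hK1 hkc (hθ β hβ)).const_mul _).symm
    _ = ∫ δ, T kz δ ∂μ := by
        refine integral_congr_ae (Filter.Eventually.of_forall fun δ => ?_)
        change ∑ β ∈ B, normKernel s (z + β) * normKernel s (mobiusTheta β z + δ) = T kz δ
        rw [hT, Finset.mul_sum, ← Finset.sum_coe_sort B]
        exact Finset.sum_congr rfl fun β _ =>
          normKernel_intertwine s (ne_zero_of_re_pos (hzβ β β.2)) (hKne δ δ.2)
    _ = r * translateIntegral μ (normKernel s) z := heig kz

end Eigenfunction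

/-! ### Uniqueness of the positive eigenfunction. -/

section Uniqueness

variable {s : ℝ} {B : Finset ℂ}

theorem transferSum_lin (s : ℝ) (B : Finset ℂ) (c d : ℝ) (f g : ℂ → ℝ) (z : ℂ) :
    transferSum s B (fun w => c * f w + d * g w) z
      = c * transferSum s B f z + d * transferSum s B g z := by
  simp only [transferSum, Finset.mul_sum, ← Finset.sum_add_distrib]
  exact Finset.sum_congr rfl fun β _ => by ring

theorem norm_deriv_mobiusTheta_rpow_pos (hB : ∀ β ∈ B, 1 ≤ β.re) {β : ℂ} (hβ : β ∈ B) {z : ℂ}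
    (hz : 0 ≤ z.re) : 0 < ‖deriv (mobiusTheta β) z‖ ^ s := by
  have h : 0 < (z + β).re := by rw [Complex.add_re]; linarith [hB β hβ]
  rw [norm_deriv_mobiusTheta_rpow s (ne_zero_of_re_pos h)]
  exact normKernel_pos s h

theorem transferSum_nonneg (hB : ∀ β ∈ B, 1 ≤ β.re) {z : ℂ} (hz : 0 ≤ z.re) {f : ℂ → ℝ}
    (hf : ∀ β ∈ B, 0 ≤ f (mobiusTheta β z)) : 0 ≤ transferSum s B f z :=
  Finset.sum_nonneg fun β hβ =>
    mul_nonneg (norm_deriv_mobiusTheta_rpow_pos hB hβ hz).le (hf β hβ)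

theorem eq_zero_of_transferSum_eq_zero (hB : ∀ β ∈ B, 1 ≤ β.re) {z : ℂ} (hz : 0 ≤ z.re)
    {f : ℂ → ℝ} (hf : ∀ β ∈ B, 0 ≤ f (mobiusTheta β z)) (h0 : transferSum s B f z = 0) {β : ℂ}
    (hβ : β ∈ B) : f (mobiusTheta β z) = 0 := by
  have h := (Finset.sum_eq_zero_iff_of_nonneg fun β hβ =>
    mul_nonneg (norm_deriv_mobiusTheta_rpow_pos (s := s) hB hβ hz).le (hf β hβ)).1 h0 β hβ
  exact (mul_eq_zero.1 h).resolve_left (norm_deriv_mobiusTheta_rpow_pos hB hβ hz).ne'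

/-- Two positive continuous eigenfunctions of the transfer operator are proportional. -/
theorem eq_const_mul_of_transferSum_eigen (hB : ∀ β ∈ B, 1 ≤ β.re) (hBne : B.Nonempty)
    {X : Set ℂ} (hX : IsCompact X) (hXne : X.Nonempty) (hre : ∀ z ∈ X, 0 ≤ z.re)
    (hmaps : ∀ β ∈ B, MapsTo (mobiusTheta β) X X) {v w : ℂ → ℝ} (hv : ContinuousOn v X)
    (hw : ContinuousOn w X) (hvpos : ∀ z ∈ X, 0 < v z) (hwpos : ∀ z ∈ X, 0 < w z) {r t : ℝ}
    (hvr : ∀ z ∈ X, transferSum s B v z = r * v z)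
    (hwt : ∀ z ∈ X, transferSum s B w z = t * w z) :
    ∃ c, 0 < c ∧ ∀ z ∈ X, w z = c * v z := by
  have hq : ContinuousOn (fun z => w z / v z) X := hw.div hv fun z hz => (hvpos z hz).ne'
  obtain ⟨a, haX, ha⟩ := hX.exists_isMaxOn hXne hq
  obtain ⟨b, hbX, hb⟩ := hX.exists_isMinOn hXne hq
  set P := w b / v b with hP
  set Q := w a / v a with hQ
  have hle : ∀ z ∈ X, 0 ≤ Q * v z + (-1) * w z := fun z hz => by
    have : w z / v z ≤ Q := ha hz
    rw [div_le_iff₀ (hvpos z hz)] at this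
    linarith
  have hge : ∀ z ∈ X, 0 ≤ (-P) * v z + 1 * w z := fun z hz => by
    have : P ≤ w z / v z := hb hz
    rw [le_div_iff₀ (hvpos z hz)] at this
    linarith
  have hwa : w a = Q * v a := by rw [hQ, div_mul_cancel₀ _ (hvpos a haX).ne']
  have hwb : w b = P * v b := by rw [hP, div_mul_cancel₀ _ (hvpos b hbX).ne']
  -- Positivity of the operator is applied to `Q * v - w` at its zero `a`, and to `w - P * v` at its
  -- zero `b`.
  have hrt : t = r := by
    apply le_antisymm
    · have h1 := transferSum_nonneg (s := s) hB (hre a haX)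
        (f := fun z => Q * v z + (-1) * w z) fun β hβ => hle _ (hmaps β hβ haX)
      rw [transferSum_lin, hvr a haX, hwt a haX] at h1
      have h2 : t * w a ≤ r * w a := by
        have : Q * (r * v a) = r * w a := by rw [hwa]; ring
        linarith
      exact le_of_mul_le_mul_right h2 (hwpos a haX)
    · have h1 := transferSum_nonneg (s := s) hB (hre b hbX)
        (f := fun z => (-P) * v z + 1 * w z) fun β hβ => hge _ (hmaps β hβ hbX)
      rw [transferSum_lin, hvr b hbX, hwt b hbX] at h1
      have h2 : r * w b ≤ t * w b := by
        have : P * (r * v b) = r * w b := by rw [hwb]; ring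
        linarith
      exact le_of_mul_le_mul_right h2 (hwpos b hbX)
  subst hrt
  obtain ⟨β, hβ⟩ := hBne
  -- With equal eigenvalues, the image of `Q * v - w` vanishes wherever the function does. A sum of
  -- non-negative terms with positive weights is then zero, so every θ_β maps maximum points to
  -- maximum points.
  have hstepQ : ∀ z ∈ X, w z / v z = Q →
      w (mobiusTheta β z) / v (mobiusTheta β z) = Q := by
    intro z hz hzQ
    rw [div_eq_iff (hvpos z hz).ne'] at hzQ
    have := eq_zero_of_transferSum_eq_zero (s := s) hB (hre z hz)
      (f := fun z => Q * v z + (-1) * w z) (fun β hβ => hle _ (hmaps β hβ hz))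
      (by rw [transferSum_lin, hvr z hz, hwt z hz, hzQ]; ring) hβ
    rw [div_eq_iff (hvpos _ (hmaps β hβ hz)).ne']
    linarith
  have hstepP : ∀ z ∈ X, w z / v z = P →
      w (mobiusTheta β z) / v (mobiusTheta β z) = P := by
    intro z hz hzP
    rw [div_eq_iff (hvpos z hz).ne'] at hzP
    have := eq_zero_of_transferSum_eq_zero (s := s) hB (hre z hz)
      (f := fun z => (-P) * v z + 1 * w z) (fun β hβ => hge _ (hmaps β hβ hz))
      (by rw [transferSum_lin, hvr z hz, hwt z hz, hzP]; ring) hβ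
    rw [div_eq_iff (hvpos _ (hmaps β hβ hz)).ne']
    linarith
  let A : Set (ℂ × ℂ) := (X ×ˢ X) ∩
    (fun y : ℂ × ℂ => (w y.1 / v y.1, w y.2 / v y.2)) ⁻¹' {(Q, P)}
  have hcont : ContinuousOn (fun y : ℂ × ℂ => (w y.1 / v y.1, w y.2 / v y.2)) (X ×ˢ X) :=
    (hq.comp continuousOn_fst fun y hy => hy.1).prodMk
      (hq.comp continuousOn_snd fun y hy => hy.2)
  have hAcpt : IsCompact A := (hX.prod hX).of_isClosed_subset
    (hcont.preimage_isClosed_of_isClosed (hX.prod hX).isClosed isClosed_singleton)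
    inter_subset_left
  -- A closest pair of a maximum point and a minimum point of w/v; if the two differed, their images
  -- under θ_β would form a closer pair.
  obtain ⟨⟨x, y⟩, hxy, hmin⟩ := hAcpt.exists_isMinOn ⟨(a, b), ⟨haX, hbX⟩, rfl⟩
    (f := fun y : ℂ × ℂ => ‖y.1 - y.2‖) (by fun_prop)
  have hxQ : w x / v x = Q := congrArg Prod.fst hxy.2
  have hyP : w y / v y = P := congrArg Prod.snd hxy.2
  have hxX : x ∈ X := hxy.1.1
  have hyX : y ∈ X := hxy.1.2
  have hxy' : x = y := by
    by_contra hne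
    have hmem : (mobiusTheta β x, mobiusTheta β y) ∈ A :=
      ⟨⟨hmaps β hβ hxX, hmaps β hβ hyX⟩, Prod.ext (hstepQ x hxX hxQ) (hstepP y hyX hyP)⟩
    exact absurd (hmin hmem) (not_le.2
      (norm_mobiusTheta_sub_lt (hB β hβ) (hre x hxX) (hre y hyX) hne))
  have hPQ : P = Q := by rw [← hyP, ← hxQ, hxy']
  refine ⟨Q, div_pos (hwpos a haX) (hvpos a haX), fun z hz => ?_⟩
  have h1 := hle z hz
  have h2 := hge z hz
  rw [hPQ] at h2
  linarith

end Uniqueness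

/-! ### The transfer operator on C^m of the closure. -/

section TransferOperator

variable {H : Opens ℂ}

theorem zeroExt_coe (f : closure (H : Set ℂ) → ℝ) (z : closure (H : Set ℂ)) :
    zeroExt f z = f z := by
  rw [zeroExt, dif_pos z.2]

theorem continuousOn_zeroExt {f : closure (H : Set ℂ) → ℝ} (hf : Continuous f) :
    ContinuousOn (zeroExt f) (closure (H : Set ℂ)) := by
  rw [continuousOn_iff_continuous_domRestrict]
  convert hf using 1
  funext z
  exact zeroExt_coe f z

theorem eqOn_zeroExt_restrict (f : ℂ → ℝ) :
    EqOn (zeroExt fun z : closure (H : Set ℂ) => f z) f (closure (H : Set ℂ)) :=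
  fun z hz => by rw [zeroExt, dif_pos hz]

theorem CmBar.hasBddExt {m : ℕ} (f : CmBar m H) : HasBddExt H ‖f‖ m (zeroExt f) :=
  HasBddExt.of_isCmBar f.isCmBar fun _ _ hab _ hz => f.abs_partialD_le_norm hab hz

/-- The transfer operator is a bounded operator on `C^m` of the closure of `H`. -/
theorem exists_transferOperator (s : ℝ) {B : Finset ℂ} (hB : ∀ β ∈ B, 1 ≤ β.re)
    (hb : Bornology.IsBounded (H : Set ℂ)) (hre : ∀ z ∈ closure (H : Set ℂ), 0 ≤ z.re)
    (hmaps : ∀ β ∈ B, MapsTo (mobiusTheta β) H H) (m : ℕ) :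
    ∃ Λ : CmBar m H →L[ℝ] CmBar m H, ∀ (f : CmBar m H) (z : closure (H : Set ℂ)),
      Λ f z = transferSum s B (zeroExt f) (z : ℂ) := by
  have hU : closure (H : Set ℂ) ⊆ rightHalfPlane (-1) := fun z hz =>
    mem_rightHalfPlane.2 (by linarith [hre z hz])
  have hweight : ∀ β ∈ B, ∀ z ∈ closure (H : Set ℂ),
      ‖deriv (mobiusTheta β) z‖ ^ s = normKernel s (z + β) := fun β hβ z hz =>
    norm_deriv_mobiusTheta_rpow s
      (ne_zero_of_re_pos (by rw [Complex.add_re]; linarith [hre z hz, hB β hβ]))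
  have hθc : ∀ β ∈ B, ContinuousOn (mobiusTheta β) (closure (H : Set ℂ)) := fun β hβ =>
    (contDiffOn_mobiusTheta (hB β hβ) 0).continuousOn.mono hU
  have hterm : ∀ β : B, ∃ C : ℝ, 0 ≤ C ∧ ∀ f : CmBar m H,
      HasBddExt H (C * ‖f‖) m
        ((fun z => normKernel s (z + β)) * (zeroExt f ∘ mobiusTheta β)) := by
    rintro ⟨β, hβ⟩
    obtain ⟨A, hA, hA'⟩ := HasBddExt.of_contDiffOn hb hU m
      (contDiffOn_normKernel_add s (hB β hβ))
    obtain ⟨K, hK, hK'⟩ := HasBddExt.comp hb hU (contDiffOn_mobiusTheta (hB β hβ)) (hmaps β hβ) m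
    refine ⟨2 ^ m * (A * K), by positivity, fun f => ?_⟩
    have := HasBddExt.mul hA (mul_nonneg hK (norm_nonneg f)) hA'
      (hK' ‖f‖ _ (norm_nonneg f) f.hasBddExt)
    rwa [show 2 ^ m * (A * K) * ‖f‖ = 2 ^ m * (A * (K * ‖f‖)) by ring]
  choose C hC hCf using hterm
  let F : CmBar m H → closure (H : Set ℂ) → ℝ := fun f z => transferSum s B (zeroExt f) z
  have hFeq : ∀ f : CmBar m H, EqOn (zeroExt (F f))
      (∑ β : B, (fun z => normKernel s (z + β)) * (zeroExt f ∘ mobiusTheta β))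
      (closure (H : Set ℂ)) := by
    intro f z hz
    rw [eqOn_zeroExt_restrict (transferSum s B (zeroExt f)) hz, Finset.sum_apply, transferSum,
      ← Finset.sum_coe_sort B]
    refine Finset.sum_congr rfl fun β _ => ?_
    rw [hweight β β.2 z hz]
    rfl
  have hFb : ∀ f : CmBar m H, HasBddExt H (∑ β, C β * ‖f‖) m (zeroExt (F f)) := fun f =>
    (HasBddExt.sum Finset.univ fun β _ => hCf β f).congr ((hFeq f).mono subset_closure)
  have hFc : ∀ f : CmBar m H, Continuous (F f) := by
    intro f
    have hc : ContinuousOn (∑ β : B, (fun z => normKernel s (z + β)) *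
        (zeroExt f ∘ mobiusTheta β)) (closure (H : Set ℂ)) := by
      refine Finset.sum_induction _ (fun f : ℂ → ℝ => ContinuousOn f (closure (H : Set ℂ)))
        (fun _ _ => ContinuousOn.add) continuousOn_const fun β _ => ?_
      exact ((contDiffOn_normKernel_add s (hB β β.2) 0).continuousOn.mono hU).mul
        ((continuousOn_zeroExt f.isCmBar.1).comp (hθc β β.2)
          ((hmaps β β.2).closure_of_continuousOn (hθc β β.2)))
    have := continuousOn_iff_continuous_domRestrict.1 (hc.congr (hFeq f))
    convert this using 1
    funext z
    exact (zeroExt_coe (F f) z).symm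
  let L : CmBar m H →ₗ[ℝ] CmBar m H :=
    { toFun := fun f => ⟨F f, (hFb f).isCmBar hb (hFc f)⟩
      map_add' := fun f g => Subtype.ext <| by
        funext z
        change transferSum s B (zeroExt (f.toFun + g.toFun)) z
          = transferSum s B (zeroExt f) z + transferSum s B (zeroExt g) z
        rw [zeroExt_add]
        simpa using! transferSum_lin s B 1 1 (zeroExt f) (zeroExt g) z
      map_smul' := fun c f => Subtype.ext <| by
        funext z
        change transferSum s B (zeroExt (c • f.toFun)) z = c * transferSum s B (zeroExt f) z
        rw [zeroExt_smul]
        simpa using! transferSum_lin s B c 0 (zeroExt f) (zeroExt f) z }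
  refine ⟨L.mkContinuous (∑ β, C β) fun f => ?_, fun f z => rfl⟩
  refine CmBar.norm_le_of_forall
    (mul_nonneg (Finset.sum_nonneg fun β _ => hC β) (norm_nonneg f)) fun a b hab z hz => ?_
  rw [Finset.sum_mul]
  exact (HasBddExt.partialD (m := 0) ((hFb f).of_le (by omega))).2 z hz

theorem isCmBar_of_contDiffOn (hb : Bornology.IsBounded (H : Set ℂ)) {U : Opens ℂ}
    (hU : closure (H : Set ℂ) ⊆ U) {f : ℂ → ℝ} (hf : ∀ n : ℕ, ContDiffOn ℝ n f U) (m : ℕ) :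
    IsCmBar m H fun z => f z := by
  obtain ⟨C, -, hC⟩ := HasBddExt.of_contDiffOn hb hU m hf
  refine (hC.congr ((eqOn_zeroExt_restrict f).mono subset_closure)).isCmBar hb ?_
  exact continuousOn_iff_continuous_domRestrict.1 ((hf 0).continuousOn.mono hU)

/-- Since `f` is smooth across the boundary of `H`, the continuous extension of a derivative is the
ordinary derivative. -/
theorem partialDBar_of_contDiffOn {U : Opens ℂ} (hU : closure (H : Set ℂ) ⊆ U) {f : ℂ → ℝ}
    (hf : ∀ n : ℕ, ContDiffOn ℝ n f U) (a b : ℕ) (z : closure (H : Set ℂ)) :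
    partialDBar a b (fun z : closure (H : Set ℂ) => f z) z = partialD a b f z := by
  refine extendFrom_eq z.2 ?_
  have hc : ContinuousOn (partialD a b f) U :=
    (contDiffOn_partialD (n := 0) (hf _)).continuousOn
  have ht : Filter.Tendsto (partialD a b f) (nhdsWithin z H) (nhds (partialD a b f z)) :=
    (hc.continuousAt (U.isOpen.mem_nhds (hU z.2))).tendsto.mono_left nhdsWithin_le_nhds
  refine ht.congr' ?_
  filter_upwards [self_mem_nhdsWithin] with w hw
  exact (eqOn_partialD a b ((eqOn_zeroExt_restrict f).mono subset_closure) hw).symm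

end TransferOperator

/-! ### From the individual bounds to the product bounds. -/

section ProductBounds

theorem abs_le_of_mem_Icc_of_le {r lo hi c : ℝ} (h : r ∈ Icc lo hi) (hlo : -c ≤ lo)
    (hhi : hi ≤ c) : |r| ≤ c := abs_le.2 ⟨hlo.trans h.1, h.2.trans hhi⟩

variable {s γ : ℝ}

/-- It lets the maximum in the third y-bound be absorbed into 2s + 1. -/
theorem sqrt_five_div_le : 25 * Real.sqrt 5 / 72 ≤ 1 := by
  have : Real.sqrt 5 ≤ 2.5 := by
    rw [Real.sqrt_le_left (by norm_num)]; norm_num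
  linarith

/-- The four bounds in the direction of `x` imply the product bounds. -/
theorem abs_le_prod_div_left (hs : 0 < s) (hγ : 0 < γ) {d : ℕ → ℝ}
    (h1 : d 1 ∈ Icc (-(2 * s / γ)) 0)
    (h2 : d 2 ∈ Icc (-(s / (4 * γ ^ 2 * (s + 1)))) (2 * s * (2 * s + 1) / γ ^ 2))
    (h3 : d 3 ∈ Icc (-(2 * s * (2 * s + 1) * (2 * s + 2) / γ ^ 3))
      (2 * s * (2 * s + 2) / (γ ^ 3 * (s + 2) ^ 2)))
    (h4 : d 4 ∈ Icc (-(2 * s * (2 * s + 2) * (3 * s + 3) / γ ^ 4))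
      (2 * s * (2 * s + 1) * (2 * s + 2) * (2 * s + 3) / γ ^ 4))
    {j : ℕ} (hj1 : 1 ≤ j) (hj4 : j ≤ 4) :
    |d j| ≤ (∏ i ∈ Finset.range j, (2 * s + i)) / γ ^ j := by
  interval_cases j
  · refine abs_le_of_mem_Icc_of_le h1 ?_ ?_
    · simp
    · simp; positivity
  · simp only [Finset.prod_range_succ, Finset.prod_range_zero]
    push_cast
    refine abs_le_of_mem_Icc_of_le h2 (neg_le_neg ?_) (le_of_eq (by ring))
    rw [show 4 * γ ^ 2 * (s + 1) = 4 * (s + 1) * γ ^ 2 by ring, ← div_div]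
    gcongr
    rw [div_le_iff₀ (by positivity)]
    nlinarith [mul_pos hs hs, pow_pos hs 3]
  · simp only [Finset.prod_range_succ, Finset.prod_range_zero]
    push_cast
    refine abs_le_of_mem_Icc_of_le h3 (le_of_eq (by ring)) ?_
    rw [mul_comm (γ ^ 3), ← div_div]
    gcongr
    rw [div_le_iff₀ (by positivity)]
    have : 1 ≤ (2 * s + 1) * (s + 2) ^ 2 := by nlinarith [mul_pos hs hs, pow_pos hs 3]
    nlinarith [mul_le_mul_of_nonneg_left this (by positivity : 0 ≤ 2 * s * (2 * s + 2))]
  · simp only [Finset.prod_range_succ, Finset.prod_range_zero]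
    push_cast
    refine abs_le_of_mem_Icc_of_le h4 (neg_le_neg ?_) (le_of_eq (by ring))
    refine div_le_div_of_nonneg_right ?_ (by positivity)
    nlinarith [mul_pos hs hs, pow_pos hs 3, pow_pos hs 4]

/-- The four bounds in the direction of `y` imply the product bounds. -/
theorem abs_le_prod_div_right (hs : 0 < s) (hγ : 0 < γ) {d : ℕ → ℝ}
    (h1 : d 1 ∈ Icc (-(s / γ)) (s / γ))
    (h2 : d 2 ∈ Icc (-(2 * s / γ ^ 2)) (2 * s * (2 * s + 1) / (4 * γ ^ 2)))
    (h3 : d 3 ∈ Icc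
      (-(2 * s * (2 * s + 2) / γ ^ 3 * max (25 * Real.sqrt 5 / 72) ((2 * s + 1) / 8)))
      (2 * s * (2 * s + 2) / γ ^ 3 * max (25 * Real.sqrt 5 / 72) ((2 * s + 1) / 8)))
    (h4 : d 4 ∈ Icc (-(2 * s * (2 * s + 2) * (3 * s + 3) / γ ^ 4))
      (2 * s * (2 * s + 1) * (2 * s + 2) * (2 * s + 3) / γ ^ 4))
    {j : ℕ} (hj1 : 1 ≤ j) (hj4 : j ≤ 4) :
    |d j| ≤ (∏ i ∈ Finset.range j, (2 * s + i)) / γ ^ j := by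
  interval_cases j
  · have h : s / γ ≤ 2 * s / γ := by gcongr; linarith
    simpa using abs_le_of_mem_Icc_of_le h1 (neg_le_neg h) h
  · simp only [Finset.prod_range_succ, Finset.prod_range_zero]
    push_cast
    refine abs_le_of_mem_Icc_of_le h2 (neg_le_neg ?_) ?_
    · exact div_le_div_of_nonneg_right (by nlinarith) (by positivity)
    · rw [← div_div]
      exact div_le_div_of_nonneg_right (by nlinarith) (by positivity)
  · have hm : max (25 * Real.sqrt 5 / 72) ((2 * s + 1) / 8) ≤ 2 * s + 1 :=
      max_le (sqrt_five_div_le.trans (by linarith)) (by linarith)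
    have h : 2 * s * (2 * s + 2) / γ ^ 3 * max (25 * Real.sqrt 5 / 72) ((2 * s + 1) / 8)
        ≤ (∏ i ∈ Finset.range 3, (2 * s + (i : ℝ))) / γ ^ 3 := by
      refine (mul_le_mul_of_nonneg_left hm (by positivity)).trans (le_of_eq ?_)
      simp only [Finset.prod_range_succ, Finset.prod_range_zero]
      push_cast
      ring
    exact abs_le_of_mem_Icc_of_le h3 (neg_le_neg h) h
  · simp only [Finset.prod_range_succ, Finset.prod_range_zero]
    push_cast
    refine abs_le_of_mem_Icc_of_le h4 (neg_le_neg ?_) (le_of_eq (by ring))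
    refine div_le_div_of_nonneg_right ?_ (by positivity)
    nlinarith [mul_pos hs hs, pow_pos hs 3, pow_pos hs 4]

end ProductBounds

/-! ### Assembly of the main theorem. -/

theorem mainTheorem6 (γ s : ℝ) (hγ : 1 ≤ γ) (hs : 0 < s)
    (B : Finset ℂ) (hB : B.Nonempty) (hBγ : ∀ β ∈ B, γ ≤ β.re)
    (H : TopologicalSpace.Opens ℂ) (hbdd : Bornology.IsBounded (H : Set ℂ))
    (hreg : MildlyRegular (H : Set ℂ)) (hG : discG γ ⊆ (H : Set ℂ))
    (hre : ∀ z ∈ H, 0 < z.re) (m : ℕ) (hm : 1 ≤ m) :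
    (∀ β ∈ B, Set.MapsTo (mobiusTheta β) (H : Set ℂ) (discG γ)) ∧
    ∃ Λ : CmBar m H →L[ℝ] CmBar m H,
      (∀ (f : CmBar m H) (z : closure (H : Set ℂ)),
        Λ f z = transferSum s B (zeroExt f) (z : ℂ)) ∧
      ∃ v : CmBar m H,
        IsPositiveEigenvector Λ v ∧
        (∀ w : CmBar m H, IsPositiveEigenvector Λ w → ∃ c : ℝ, 0 < c ∧ w = c • v) ∧
        (∀ k : ℕ, IsCmBar k H v) ∧
        ∀ z : closure (H : Set ℂ),
          (-(2 * s / γ) ≤ partialDBar 1 0 v z / v z ∧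
            partialDBar 1 0 v z / v z ≤ 0) ∧
          (-(s / (4 * γ ^ 2 * (s + 1))) ≤ partialDBar 2 0 v z / v z ∧
            partialDBar 2 0 v z / v z ≤ 2 * s * (2 * s + 1) / γ ^ 2) ∧
          (-(2 * s * (2 * s + 1) * (2 * s + 2) / γ ^ 3) ≤ partialDBar 3 0 v z / v z ∧
            partialDBar 3 0 v z / v z ≤ 2 * s * (2 * s + 2) / (γ ^ 3 * (s + 2) ^ 2)) ∧
          (-(2 * s * (2 * s + 2) * (3 * s + 3) / γ ^ 4) ≤ partialDBar 4 0 v z / v z ∧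
            partialDBar 4 0 v z / v z ≤
              2 * s * (2 * s + 1) * (2 * s + 2) * (2 * s + 3) / γ ^ 4) ∧
          |partialDBar 0 1 v z| / v z ≤ s / γ ∧
          (-(2 * s / γ ^ 2) ≤ partialDBar 0 2 v z / v z ∧
            partialDBar 0 2 v z / v z ≤ 2 * s * (2 * s + 1) / (4 * γ ^ 2)) ∧
          |partialDBar 0 3 v z| / v z ≤
            2 * s * (2 * s + 2) / γ ^ 3 * max (25 * Real.sqrt 5 / 72) ((2 * s + 1) / 8) ∧
          (-(2 * s * (2 * s + 2) * (3 * s + 3) / γ ^ 4) ≤ partialDBar 0 4 v z / v z ∧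
            partialDBar 0 4 v z / v z ≤
              2 * s * (2 * s + 1) * (2 * s + 2) * (2 * s + 3) / γ ^ 4) ∧
          ∀ j : ℕ, 1 ≤ j → j ≤ 4 →
            |partialDBar j 0 v z| / v z ≤ (∏ i ∈ Finset.range j, (2 * s + i)) / γ ^ j ∧
            |partialDBar 0 j v z| / v z ≤ (∏ i ∈ Finset.range j, (2 * s + i)) / γ ^ j := by

  have hγ0 : 0 < γ := by linarith
  have hB1 : ∀ β ∈ B, 1 ≤ β.re := fun β hβ => hγ.trans (hBγ β hβ)
  have hmapsG : ∀ β ∈ B, MapsTo (mobiusTheta β) (H : Set ℂ) (discG γ) := fun β hβ z hz =>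
    mobiusTheta_mem_discG hγ0 (by rw [Complex.add_re]; linarith [hre z hz, hBγ β hβ])
  have hmaps : ∀ β ∈ B, MapsTo (mobiusTheta β) (H : Set ℂ) H := fun β hβ =>
    (hmapsG β hβ).mono_right hG
  have hre' : ∀ z ∈ closure (H : Set ℂ), 0 ≤ z.re := fun z hz =>
    closure_minimal (fun z hz => (hre z hz).le)
      (isClosed_le continuous_const Complex.continuous_re) hz
  have hU : closure (H : Set ℂ) ⊆ rightHalfPlane (-1) := fun z hz =>
    mem_rightHalfPlane.2 (by linarith [hre' z hz])
  have hmapsC : ∀ β ∈ B, MapsTo (mobiusTheta β) (closure (H : Set ℂ)) (closure (H : Set ℂ)) :=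
    fun β hβ => (hmaps β hβ).closure_of_continuousOn
      ((contDiffOn_mobiusTheta (hB1 β hβ) 0).continuousOn.mono hU)
  have hHne : (closure (H : Set ℂ)).Nonempty := by
    refine ⟨1 / (2 * (γ : ℂ)), subset_closure (hG ?_)⟩
    simp [discG, hγ0]
  refine ⟨hmapsG, ?_⟩
  obtain ⟨Λ, hΛ⟩ := exists_transferOperator s hB1 hbdd hre' hmaps m
  refine ⟨Λ, hΛ, ?_⟩
  obtain ⟨K, _, μ, _, r, hK, hμ, -, heig⟩ := exists_translateIntegral_eigenfunction s hγ hB hBγ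
  have hK1 : ∀ δ ∈ K, 1 ≤ δ.re := fun δ hδ => hγ.trans (hK δ hδ)
  have hk := contDiffOn_normKernel s
  have hkpos : ∀ w ∈ rightHalfPlane 0, 0 < normKernel s w := fun w hw => normKernel_pos s hw
  have hV : ∀ n : ℕ, ContDiffOn ℝ n (translateIntegral μ (normKernel s)) (rightHalfPlane (-1)) :=
    fun n => contDiffOn_translateIntegral hK1 (hk (n + 1))
  have hVpos : ∀ z ∈ closure (H : Set ℂ), 0 < translateIntegral μ (normKernel s) z := fun z hz =>
    translateIntegral_pos hK1 hμ (hk 0).continuousOn hkpos (hU hz)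
  -- The order is left free: the same function lies in every C^k, so smoothness needs no separate
  -- argument.
  have hCm := isCmBar_of_contDiffOn hbdd hU hV
  let v : CmBar m H := ⟨_, hCm m⟩
  have hvV : ∀ z : closure (H : Set ℂ), v z = translateIntegral μ (normKernel s) z := fun z => rfl
  have hvext : EqOn (zeroExt v) (translateIntegral μ (normKernel s)) (closure (H : Set ℂ)) :=
    eqOn_zeroExt_restrict (H := H) (translateIntegral μ (normKernel s))
  have hvr : ∀ z ∈ closure (H : Set ℂ), transferSum s B (zeroExt v) z = r * zeroExt v z := by
    intro z hz
    rw [hvext hz, ← heig z (hre' z hz)]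
    exact Finset.sum_congr rfl fun β hβ => by rw [hvext (hmapsC β hβ hz)]
  have hvpos : ∀ z : closure (H : Set ℂ), 0 < v z := fun z => hVpos z z.2
  have hvne : v ≠ 0 := by
    obtain ⟨z, hz⟩ := hHne
    intro h0
    have h1 := hvpos ⟨z, hz⟩
    rw [h0] at h1
    exact lt_irrefl _ h1
  have hext_pos : ∀ w : CmBar m H, (∀ z, 0 < w z) →
      ∀ z ∈ closure (H : Set ℂ), 0 < zeroExt w z := fun w hw z hz => by
    rw [zeroExt, dif_pos hz]; exact hw ⟨z, hz⟩
  refine ⟨v, ⟨hvpos, r, Module.End.hasEigenvector_iff.2 ⟨Module.End.mem_eigenspace_iff.2 ?_, hvne⟩⟩,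
    ?_, hCm, fun z => ?_⟩
  · refine Subtype.ext (funext fun z => ?_)
    change Λ v z = r * v z
    rw [hΛ, hvr z z.2, zeroExt_coe]
  · rintro w ⟨hwpos, t, hwt⟩
    have hwt' : Λ w = t • w := Module.End.mem_eigenspace_iff.1 hwt.1
    obtain ⟨c, hc, hcw⟩ := eq_const_mul_of_transferSum_eigen hB1 hB hbdd.isCompact_closure hHne hre'
      hmapsC (continuousOn_zeroExt v.isCmBar.1) (continuousOn_zeroExt w.isCmBar.1)
      (hext_pos v hvpos) (hext_pos w hwpos) hvr (t := t) fun z hz => by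
        rw [← hΛ w ⟨z, hz⟩, hwt', zeroExt, dif_pos hz]
        rfl
    refine ⟨c, hc, Subtype.ext (funext fun z => ?_)⟩
    have := hcw z z.2
    rw [zeroExt_coe, zeroExt_coe] at this
    exact this
  · have hz0 := hre' z z.2
    have hcont : ∀ a b, ContinuousOn (partialD a b (normKernel s)) (rightHalfPlane 0) :=
      fun a b => (contDiffOn_partialD (n := 0) (hk _)).continuousOn
    -- Every estimate for `v` reduces to the same estimate for the kernel on Re w ≥ γ.
    have key : ∀ (a b : ℕ) (lo hi : ℝ),
        (∀ w : ℂ, γ ≤ w.re → partialD a b (normKernel s) w / normKernel s w ∈ Icc lo hi) →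
        partialDBar a b v z / v z ∈ Icc lo hi := by
      intro a b lo hi h
      have e : partialDBar a b v z = translateIntegral μ (partialD a b (normKernel s)) z :=
        (partialDBar_of_contDiffOn hU hV a b z).trans
          (partialD_translateIntegral hK1 hk a b (hU z.2))
      rw [e, hvV]
      exact translateIntegral_div_mem_Icc hγ hK hμ (hk 0).continuousOn (hcont a b) hkpos h hz0
    have hX : ∀ j : ℕ, j ≤ 4 → ∀ w : ℂ, γ ≤ w.re →
        partialD j 0 (normKernel s) w / normKernel s w
          = kernelDeriv s j w.re w.im / kernelDeriv s 0 w.re w.im := fun j hj w hw => by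
      rw [partialD_normKernel_left s hj (hγ0.trans_le hw)]
      rfl
    have hY : ∀ j : ℕ, j ≤ 4 → ∀ w : ℂ, γ ≤ w.re →
        partialD 0 j (normKernel s) w / normKernel s w
          = kernelDeriv s j w.im w.re / kernelDeriv s 0 w.im w.re := fun j hj w hw => by
      have h0 := partialD_normKernel_right s (Nat.zero_le 4) (hγ0.trans_le hw)
      rw [partialD_normKernel_right s hj (hγ0.trans_le hw)]
      exact congrArg _ h0
    have x1 := key 1 0 _ _ fun w hw => by
      rw [hX 1 (by norm_num) w hw]; exact (kernelDeriv_left_mem_Icc hs hγ0 hw w.im).1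
    have x2 := key 2 0 _ _ fun w hw => by
      rw [hX 2 (by norm_num) w hw]; exact (kernelDeriv_left_mem_Icc hs hγ0 hw w.im).2.1
    have x3 := key 3 0 _ _ fun w hw => by
      rw [hX 3 (by norm_num) w hw]; exact (kernelDeriv_left_mem_Icc hs hγ0 hw w.im).2.2.1
    have x4 := key 4 0 _ _ fun w hw => by
      rw [hX 4 (by norm_num) w hw]; exact (kernelDeriv_left_mem_Icc hs hγ0 hw w.im).2.2.2
    have y1 := key 0 1 _ _ fun w hw => by
      rw [hY 1 (by norm_num) w hw]; exact (kernelDeriv_right_mem_Icc hs hγ0 hw w.im).1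
    have y2 := key 0 2 _ _ fun w hw => by
      rw [hY 2 (by norm_num) w hw]; exact (kernelDeriv_right_mem_Icc hs hγ0 hw w.im).2.1
    have y3 := key 0 3 _ _ fun w hw => by
      rw [hY 3 (by norm_num) w hw]; exact (kernelDeriv_right_mem_Icc hs hγ0 hw w.im).2.2.1
    have y4 := key 0 4 _ _ fun w hw => by
      rw [hY 4 (by norm_num) w hw]; exact (kernelDeriv_right_mem_Icc hs hγ0 hw w.im).2.2.2
    have habs : ∀ a b, |partialDBar a b v z| / v z = |partialDBar a b v z / v z| := fun a b => by
      rw [abs_div, abs_of_pos (hvpos z)]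
    refine ⟨x1, x2, x3, x4, ?_, y2, ?_, y4, fun j hj1 hj4 => ⟨?_, ?_⟩⟩
    · rw [habs]; exact abs_le.2 y1
    · rw [habs]; exact abs_le.2 y3
    · rw [habs]
      exact abs_le_prod_div_left (d := fun j => partialDBar j 0 v z / v z) hs hγ0 x1 x2 x3 x4 hj1 hj4
    · rw [habs]
      exact abs_le_prod_div_right (d := fun j => partialDBar 0 j v z / v z) hs hγ0 y1 y2 y3 y4
        hj1 hj4
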